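/- Let $\mathcal X$ be a finite alphabet, let $P_1,P_2$ be probability distributions on $\mathcal X$, and let $\log$ be the natural logarithm. For $\alpha\ge 0$ let $$\mathrm{GJS}(P,Q,\alpha)=\alpha D(P\|P_\alpha)+D(Q\|P_\alpha),\qquad P_\alpha=\frac{\alpha P+Q}{1+\alpha},$$ where $D$ is the relative entropy, and let $C(P_1,P_2)=-\inf_{\eta\in[0,1]}\log\sum_{x\in\mathcal X}P_1(x)^{\eta}P_2(x)^{1-\eta}\in[0,\infty]$ be the Chernoff information. Let $0<\gamma\le C(P_1,P_2)$, $\gamma<\infty$; if $\gamma=C(P_1,P_2)$, assume that $P_1$ and $P_2$ have the same support. For $N\in\mathbb N$ let $X_1^N$ and $X_2^N$ be i.i.d. words of length $N$ drawn from $P_1$ and from $P_2$, and let $Y_1,Y_2,\dots$ be i.i.d. with law $P_i$ under hypothesis $H_i$ ($i\in\{1,2\}$), the three families being independent; $\mathrm P_i,\mathbb E_i$ are probability and expectation under $H_i$. Let $\mathsf T_w$ be the empirical distribution of a word $w$, and $S_j(n)=n\,\mathrm{GJS}(\mathsf T_{X_j^N},\mathsf T_{Y^n},N/n)$ for $n\ge1$.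 The sequential test $\Phi_{\rm seq}(\gamma)$ stops at $$T=\min\bigl(\inf\{n\ge 1: S_1(n)\ge\gamma N\ \text{or}\ S_2(n)\ge\gamma N\},\,N^2\bigr)$$ and decides $H_1$ if $S_2(T)\ge\gamma N>S_1(T)$ and $H_2$ if $S_1(T)\ge\gamma N>S_2(T)$; if both or neither of the scores reach $\gamma N$ at time $T$, its decision is an arbitrary function of $(X_1^N,X_2^N,Y^T)$. Let $\mathrm P_i^{\rm err}$ be the probability under $H_i$ that the decision is not $H_i$, and $$\mathsf e_i(\Phi_{\rm seq}(\gamma))=\liminf_{N\to\infty}\frac{-\log \mathrm P_i^{\rm err}}{\mathbb E_i[T]}\qquad(-\log 0=\infty).$$ Then each of the equations $\mathrm{GJS}(P_2,P_1,\beta)=\gamma\beta$ and $\mathrm{GJS}(P_1,P_2,\theta)=\gamma\theta$ has a unique positive solution, $\beta^\star_\gamma$ and $\theta^\star_\gamma$ respectively, and for every choice of the free decisions $\mathrm P_1^{\rm err}\to0$ and $\mathrm P_2^{\rm err}\to0$ as $N\to\infty$, and $$\mathsf e_1(\Phi_{\rm seq}(\gamma))\ge \mathrm{GJS}(P_2,P_1,\beta^\star_\gamma),\qquad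 \mathsf e_2(\Phi_{\rm seq}(\gamma))\ge \mathrm{GJS}(P_1,P_2,\theta^\star_\gamma).$$ -/

import Mathlib

open MeasureTheory Filter Topology
open scoped ENNReal

noncomputable section

namespace SeqClass

/-- The two hypotheses: the test sequence has the same source as the first (`H1`) or as the
second (`H2`) training sequence. -/
inductive Hyp : Type
  | H1
  | H2

variable {X : Type*} [Fintype X]

/-- The probability mass function of `P` as a vector of real numbers. -/
def pmfReal (P : PMF X) : X → ℝ := fun x => (P x).toReal

/-- The relative entropy (Kullback-Leibler divergence) `∑ p(x) log (p(x) / q(x))` in nats, with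
`0 log (0 / q) = 0`. It is only ever used where `q` vanishes nowhere on the support of `p`, or
with a coefficient `0`. -/
def relEntropy (p q : X → ℝ) : ℝ := ∑ x, p x * Real.log (p x / q x)

/-- The generalized Jensen-Shannon divergence
`α D(p ‖ m) + D(q ‖ m)` with `m = (α p + q) / (1 + α)`, for `α ≥ 0`. -/
def GJS (p q : X → ℝ) (α : ℝ) : ℝ :=
  α * relEntropy p (fun x => (α * p x + q x) / (1 + α)) +
    relEntropy q (fun x => (α * p x + q x) / (1 + α))

/-- The Chernoff information
`- inf_{η ∈ [0,1]} log ∑ P(x)^η Q(x)^(1-η)`; it is `⊤` if the supports are disjoint. -/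
def chernoff (P Q : PMF X) : EReal :=
  -(⨅ η ∈ Set.Icc (0 : ℝ) 1, ENNReal.log (∑ x, P x ^ η * Q x ^ (1 - η)))

open scoped Classical in
/-- The type (empirical distribution) of a word of length `n`. -/
def empirical {n : ℕ} (x : Fin n → X) : X → ℝ :=
  fun a => (1 / (n : ℝ)) * ∑ i, if x i = a then (1 : ℝ) else 0

/-- The score `n GJS(type of x, type of y, N / n)` of a training word `x` of length `N` against a
test word `y` of length `n`. -/
def score {N n : ℕ} (x : Fin N → X) (y : Fin n → X) : ℝ :=
  (n : ℝ) * GJS (empirical x) (empirical y) ((N : ℝ) / (n : ℝ))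

/-- The first `n` letters of a sequence. -/
def initial {A : Type*} (n : ℕ) (y : ℕ → A) : Fin n → A := fun k => y k

/-- A test with training words of length `N`: a stopping time `T` and a decision rule `d`.
The letters of the test sequence are `y 0, y 1, …`. The field `stopping` says that `T = n` is
decided by the training words and the first `n` letters of the test sequence, that is, `T` is
a stopping time of the filtration that they generate; the decision is a function of
the training words and of the `T` observed letters. -/
structure Test (A : Type*) (N : ℕ) where
  T : (Fin N → A) → (Fin N → A) → (ℕ → A) → ℕ
  stopping : ∀ (x₁ x₂ : Fin N → A) (y y' : ℕ → A),
    (∀ k < T x₁ x₂ y, y k = y' k) → T x₁ x₂ y' = T x₁ x₂ y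
  d : (Fin N → A) → (Fin N → A) → (n : ℕ) → (Fin n → A) → Hyp

/-- The source of the test sequence under a hypothesis. -/
def Hyp.source (P₁ P₂ : PMF X) : Hyp → PMF X
  | Hyp.H1 => P₁
  | Hyp.H2 => P₂

/-- The joint law under a hypothesis: training words i.i.d. from `P₁` and from `P₂`, test sequence
i.i.d. from the source that the hypothesis names, all independent. -/
def law [MeasurableSpace X] (P₁ P₂ : PMF X) (i : Hyp) (N : ℕ) :
    Measure ((Fin N → X) × (Fin N → X) × (ℕ → X)) :=
  (Measure.pi fun _ : Fin N => P₁.toMeasure).prod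
    ((Measure.pi fun _ : Fin N => P₂.toMeasure).prod
      (Measure.infinitePi fun _ : ℕ => (i.source P₁ P₂).toMeasure))

/-- The probability, under hypothesis `i`, that the test does not decide for `i`. -/
def errorProb [MeasurableSpace X] (P₁ P₂ : PMF X) (i : Hyp) {N : ℕ} (Φ : Test X N) : ℝ≥0∞ :=
  law P₁ P₂ i N {ω | Φ.d ω.1 ω.2.1 (Φ.T ω.1 ω.2.1 ω.2.2)
    (initial (Φ.T ω.1 ω.2.1 ω.2.2) ω.2.2) ≠ i}

/-- The expected number of test samples under hypothesis `i`. -/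
def expectedTime [MeasurableSpace X] (P₁ P₂ : PMF X) (i : Hyp) {N : ℕ} (Φ : Test X N) : ℝ≥0∞ :=
  ∫⁻ ω, (Φ.T ω.1 ω.2.1 ω.2.2 : ℝ≥0∞) ∂(law P₁ P₂ i N)

/-- The error exponent `liminf_N (- log P_i^err) / E_i[T]` of a family of tests, with
`- log 0 = ⊤`. -/
def errorExponent [MeasurableSpace X] (P₁ P₂ : PMF X) (i : Hyp) (Φ : (N : ℕ) → Test X N) :
    EReal :=
  liminf (fun N => -ENNReal.log (errorProb P₁ P₂ i (Φ N)) /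
    ((expectedTime P₁ P₂ i (Φ N) : ℝ≥0∞) : EReal)) atTop

/-- The times `n ≥ 1` at which one of the two scores is at least `γ N`. -/
def crossings (γ : ℝ) {N : ℕ} (x₁ x₂ : Fin N → X) (y : ℕ → X) : Set ℕ :=
  {n | 1 ≤ n ∧ (γ * N ≤ score x₁ (initial n y) ∨ γ * N ≤ score x₂ (initial n y))}

/-- The minimum of the first crossing time (infinite if there is none) and `N ^ 2`. -/
def seqTime (γ : ℝ) {N : ℕ} (x₁ x₂ : Fin N → X) (y : ℕ → X) : ℕ :=
  sInf (insert (N ^ 2) (crossings γ x₁ x₂ y))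

theorem seqTime_stopping (γ : ℝ) {N : ℕ} (x₁ x₂ : Fin N → X) (y y' : ℕ → X)
    (h : ∀ k < seqTime γ x₁ x₂ y, y k = y' k) :
    seqTime γ x₁ x₂ y' = seqTime γ x₁ x₂ y := by
  have key : ∀ n ≤ seqTime γ x₁ x₂ y, initial n y = initial n y' := by
    intro n hn
    funext k
    exact h k (lt_of_lt_of_le k.2 hn)
  have mem : ∀ z : ℕ → X, seqTime γ x₁ x₂ z ∈ insert (N ^ 2) (crossings γ x₁ x₂ z) :=
    fun z => Nat.sInf_mem (Set.insert_nonempty _ _)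
  have tr : ∀ n ≤ seqTime γ x₁ x₂ y, (n ∈ insert (N ^ 2) (crossings γ x₁ x₂ y) ↔
      n ∈ insert (N ^ 2) (crossings γ x₁ x₂ y')) := by
    intro n hn
    simp only [Set.mem_insert_iff, crossings, Set.mem_ofPred_eq, key n hn]
  have h1 : seqTime γ x₁ x₂ y' ≤ seqTime γ x₁ x₂ y :=
    Nat.sInf_le ((tr _ le_rfl).1 (mem y))
  exact le_antisymm h1 (Nat.sInf_le ((tr _ h1).2 (mem y')))

/-- The decision rules of the sequential test: decide for `H1` if the score of the second class
(only) has reached `γ N`, and for `H2` if the score of the first class (only) has. The decision is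
left free where both scores or neither have reached it. -/
def IsSeqRule (γ : ℝ) {N : ℕ}
    (d : (Fin N → X) → (Fin N → X) → (n : ℕ) → (Fin n → X) → Hyp) : Prop :=
  ∀ (x₁ x₂ : Fin N → X) (n : ℕ) (y : Fin n → X),
    (γ * N ≤ score x₂ y → ¬ γ * N ≤ score x₁ y → d x₁ x₂ n y = Hyp.H1) ∧
    (γ * N ≤ score x₁ y → ¬ γ * N ≤ score x₂ y → d x₁ x₂ n y = Hyp.H2)

/-- The sequential test with threshold `γ` and decision rule `d`. -/
def seqTest (γ : ℝ) {N : ℕ}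
    (d : (Fin N → X) → (Fin N → X) → (n : ℕ) → (Fin n → X) → Hyp) : Test X N where
  T := seqTime γ
  stopping := seqTime_stopping γ
  d := d

/-- `α` is the unique positive solution of `GJS(P, Q, α) = γ α`. -/
def IsTheSolution (P Q : PMF X) (γ α : ℝ) : Prop :=
  0 < α ∧ GJS (pmfReal P) (pmfReal Q) α = γ * α ∧
    ∀ a : ℝ, 0 < a → GJS (pmfReal P) (pmfReal Q) a = γ * a → a = α

end SeqClass

end

/-! The two hypotheses are mirror images. Let `q` be the law of the test letters and of the matching
training word, and `p` the law of the other training word. An error requires that the matching score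
reach `γ N` at some `n ≤ N ^ 2`, or that the mismatched score still be below `γ N` at time `N ^ 2`.

Write `V`, `W` for the types of the training and test words and `H` for entropy. Since the mixture
minimizes `m ↦ α D(V ‖ m) + D(W ‖ m)`, a pair of words from one source with score at least `s` has
probability at most `e^{-s} e^{-N H(V) - n H(W)}`. There are only polynomially many types
(`sum_exp_ent_le`), so the first event costs `e^{-γ N}` up to a polynomial. At `n = N ^ 2` the
mixture is close to `W`, hence to `q`, and a mismatched score below `γ N` forces `D(V ‖ mix) < γ`.
Gibbs' inequality with the weights `mix^η p^(1-η)` makes `η D(V ‖ mix) + (1-η) D(V ‖ p)` at least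
about `γ`, so `D(V ‖ p)` is at least about `γ` (`wordProb_le_of_score_lt`). The error probability is
therefore at most `e^{-N(γ - δ)}` eventually, for every `δ > 0`.

For `t > 1 / β` one has `GJS(p, q, 1/t) > γ / t`, so the mismatched score has crossed at time `⌈t
N⌉` outside an event of exponentially small probability, on which the cap `N ^ 2` bounds the time.
Thus `E[T] ≤ t N + 2`, and letting `t` decrease to `1 / β` gives the exponent `γ β = GJS(p, q, β)`.

The equation is solvable because `GJS(p, q, α) / α` is strictly decreasing, falls below `γ` for
large `α` (logarithmic growth of `GJS`), and exceeds `γ` near `0` by the same Gibbs argument. Both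
uses need an exponent `η` strictly inside `(0, 1)` with Chernoff coefficient at most `e^{-γ}`; at `γ
= C` this is what equality of supports provides. -/

noncomputable section

namespace SeqClass

variable {X : Type*} [Fintype X]

/-! ### Probability vectors, relative entropy and Gibbs' inequality. -/

/-- A probability vector on a finite alphabet. -/
structure IsProb (v : X → ℝ) : Prop where
  nonneg : ∀ x, 0 ≤ v x
  sum_eq_one : ∑ x, v x = 1

theorem isProb_pmfReal (P : PMF X) : IsProb (pmfReal P) where
  nonneg _ := ENNReal.toReal_nonneg
  sum_eq_one := by
    have h := P.tsum_coe
    rw [tsum_fintype] at h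
    simp only [pmfReal]
    rw [← ENNReal.toReal_sum fun a _ => P.apply_ne_top a, h, ENNReal.toReal_one]

theorem IsProb.le_one {v : X → ℝ} (hv : IsProb v) (x : X) : v x ≤ 1 :=
  hv.sum_eq_one ▸ Finset.single_le_sum (fun i _ => hv.nonneg i) (Finset.mem_univ x)

/-- The mixture `(α p + q) / (1 + α)`. -/
def mix (p q : X → ℝ) (α : ℝ) : X → ℝ := fun x => (α * p x + q x) / (1 + α)

/-- The Shannon entropy in nats. -/
def ent (v : X → ℝ) : ℝ := ∑ x, Real.negMulLog (v x)

theorem GJS_eq_mix (p q : X → ℝ) (α : ℝ) :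
    GJS p q α = α * relEntropy p (mix p q α) + relEntropy q (mix p q α) := rfl

theorem IsProb.mix {p q : X → ℝ} (hp : IsProb p) (hq : IsProb q) {α : ℝ} (hα : 0 ≤ α) :
    IsProb (mix p q α) where
  nonneg x := by
    have := hp.nonneg x
    have := hq.nonneg x
    unfold SeqClass.mix
    positivity
  sum_eq_one := by
    unfold SeqClass.mix
    rw [← Finset.sum_div, Finset.sum_add_distrib, ← Finset.mul_sum, hp.sum_eq_one,
      hq.sum_eq_one]
    field_simp
    ring

theorem mix_ne_zero_left {p q : X → ℝ} (hp : IsProb p) (hq : IsProb q) {α : ℝ} (hα : 0 < α)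
    {x : X} (h : p x ≠ 0) : mix p q α x ≠ 0 := by
  have h1 := (hp.nonneg x).lt_of_ne' h
  have h2 := hq.nonneg x
  unfold mix
  positivity

theorem mix_ne_zero_right {p q : X → ℝ} (hp : IsProb p) (hq : IsProb q) {α : ℝ} (hα : 0 ≤ α)
    {x : X} (h : q x ≠ 0) : mix p q α x ≠ 0 := by
  have h1 := (hq.nonneg x).lt_of_ne' h
  have h2 := hp.nonneg x
  unfold mix
  positivity

theorem relEntropy_eq (v q : X → ℝ) (h : ∀ x, v x ≠ 0 → q x ≠ 0) :
    relEntropy v q = -ent v - ∑ x, v x * Real.log (q x) := by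
  unfold relEntropy ent
  rw [← Finset.sum_neg_distrib, ← Finset.sum_sub_distrib]
  refine Finset.sum_congr rfl fun x _ => ?_
  by_cases hx : v x = 0
  · simp [hx]
  · rw [Real.log_div hx (h x hx), Real.negMulLog]
    ring

theorem sub_le_mul_log_div {a b : ℝ} (ha : 0 ≤ a) (hb : 0 ≤ b) (h : a ≠ 0 → b ≠ 0) :
    a - b ≤ a * Real.log (a / b) := by
  rcases ha.eq_or_lt with rfl | ha
  · simpa using hb
  have hb := hb.lt_of_ne' (h ha.ne')
  have h1 := Real.log_le_sub_one_of_pos (div_pos hb ha)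
  rw [← inv_div, Real.log_inv]
  have h2 := mul_le_mul_of_nonneg_left h1 ha.le
  have h3 : a * (b / a - 1) = b - a := by field_simp
  linarith

theorem sub_lt_mul_log_div {a b : ℝ} (ha : 0 < a) (hb : 0 < b) (h : a ≠ b) :
    a - b < a * Real.log (a / b) := by
  have h1 := Real.log_lt_sub_one_of_pos (div_pos hb ha)
    (fun hh => h ((div_eq_one_iff_eq ha.ne').1 hh).symm)
  rw [← inv_div, Real.log_inv]
  have h2 := mul_lt_mul_of_pos_left h1 ha
  have h3 : a * (b / a - 1) = b - a := by field_simp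
  linarith

/-- Gibbs' inequality for a vector `q` that need not be normalized. -/
theorem neg_log_sum_le_relEntropy {v q : X → ℝ} (hv : IsProb v) (hq : ∀ x, 0 ≤ q x)
    (h : ∀ x, v x ≠ 0 → q x ≠ 0) : -Real.log (∑ x, q x) ≤ relEntropy v q := by
  obtain ⟨a, ha⟩ : ∃ a, v a ≠ 0 := by
    by_contra! hc
    have := hv.sum_eq_one
    simp [hc] at this
  have hZ : 0 < ∑ x, q x :=
    Finset.sum_pos' (fun x _ => hq x) ⟨a, Finset.mem_univ a, (hq a).lt_of_ne' (h a ha)⟩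
  set Z := ∑ x, q x
  have key : ∑ x, (v x - q x / Z) ≤ ∑ x, v x * Real.log (v x / (q x / Z)) :=
    Finset.sum_le_sum fun x _ => sub_le_mul_log_div (hv.nonneg x) (div_nonneg (hq x) hZ.le)
      fun hx => div_ne_zero (h x hx) hZ.ne'
  have e1 : ∑ x, (v x - q x / Z) = 0 := by
    rw [Finset.sum_sub_distrib, ← Finset.sum_div, hv.sum_eq_one, div_self hZ.ne', sub_self]
  have e2 : ∑ x, v x * Real.log (v x / (q x / Z)) = relEntropy v q + Real.log Z := by
    have : Real.log Z = ∑ x, v x * Real.log Z := by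
      rw [← Finset.sum_mul, hv.sum_eq_one, one_mul]
    rw [this, relEntropy, ← Finset.sum_add_distrib]
    refine Finset.sum_congr rfl fun x _ => ?_
    by_cases hx : v x = 0
    · simp [hx]
    · rw [div_div_eq_mul_div, mul_div_right_comm, Real.log_mul (div_ne_zero hx (h x hx)) hZ.ne']
      ring
  linarith

theorem relEntropy_nonneg {v q : X → ℝ} (hv : IsProb v) (hq : IsProb q)
    (h : ∀ x, v x ≠ 0 → q x ≠ 0) : 0 ≤ relEntropy v q := by
  simpa [hq.sum_eq_one] using neg_log_sum_le_relEntropy hv hq.nonneg h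

theorem relEntropy_pos {v q : X → ℝ} (hv : IsProb v) (hq : IsProb q)
    (h : ∀ x, v x ≠ 0 → q x ≠ 0) (hne : v ≠ q) : 0 < relEntropy v q := by
  have : ∃ x, q x < v x := by
    by_contra! hc
    refine hne (funext fun x => ?_)
    have hs : ∑ x, (q x - v x) = 0 := by
      rw [Finset.sum_sub_distrib, hv.sum_eq_one, hq.sum_eq_one, sub_self]
    have := (Finset.sum_eq_zero_iff_of_nonneg fun x _ => sub_nonneg.2 (hc x)).1 hs x
      (Finset.mem_univ x)
    linarith
  obtain ⟨a, ha⟩ := this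
  have hva : 0 < v a := (hq.nonneg a).trans_lt ha
  have key : ∑ x, (v x - q x) < ∑ x, v x * Real.log (v x / q x) :=
    Finset.sum_lt_sum
      (fun x _ => sub_le_mul_log_div (hv.nonneg x) (hq.nonneg x) (h x))
      ⟨a, Finset.mem_univ a,
        sub_lt_mul_log_div hva ((hq.nonneg a).lt_of_ne' (h a hva.ne')) ha.ne'⟩
  rw [Finset.sum_sub_distrib, hv.sum_eq_one, hq.sum_eq_one, sub_self] at key
  exact key

/-! ### The divergence `GJS`: variational form, monotonicity and growth. -/

theorem GJS_eq_cross {p q : X → ℝ} {α : ℝ} (hα : 0 < α)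
    {m : X → ℝ} (hmp : ∀ x, p x ≠ 0 → m x ≠ 0) (hmq : ∀ x, q x ≠ 0 → m x ≠ 0) :
    α * relEntropy p m + relEntropy q m =
      -α * ent p - ent q - (1 + α) * ∑ x, mix p q α x * Real.log (m x) := by
  rw [relEntropy_eq p m hmp, relEntropy_eq q m hmq]
  have : (1 + α) * ∑ x, mix p q α x * Real.log (m x) =
      α * ∑ x, p x * Real.log (m x) + ∑ x, q x * Real.log (m x) := by
    rw [Finset.mul_sum, Finset.mul_sum, ← Finset.sum_add_distrib]
    refine Finset.sum_congr rfl fun x _ => ?_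
    unfold mix
    field_simp
  rw [this]
  ring

/-- The generalized Jensen-Shannon divergence in terms of entropies. -/
theorem GJS_eq_ent {p q : X → ℝ} (hp : IsProb p) (hq : IsProb q) {α : ℝ} (hα : 0 < α) :
    GJS p q α = (1 + α) * ent (mix p q α) - α * ent p - ent q := by
  rw [GJS_eq_mix, GJS_eq_cross hα (fun x => mix_ne_zero_left hp hq hα)
    (fun x => mix_ne_zero_right hp hq hα.le)]
  have : ∑ x, mix p q α x * Real.log (mix p q α x) = -ent (mix p q α) := by
    simp [ent, Real.negMulLog]
  rw [this]
  ring

/-- The mixture minimizes `m ↦ α D(p ‖ m) + D(q ‖ m)`. -/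
theorem GJS_le {p q : X → ℝ} (hp : IsProb p) (hq : IsProb q) {α : ℝ} (hα : 0 < α)
    {m : X → ℝ} (hm : IsProb m) (hmp : ∀ x, p x ≠ 0 → m x ≠ 0)
    (hmq : ∀ x, q x ≠ 0 → m x ≠ 0) :
    GJS p q α ≤ α * relEntropy p m + relEntropy q m := by
  have h0 : ∀ x, mix p q α x ≠ 0 → m x ≠ 0 := by
    intro x hx
    by_cases h1 : p x = 0
    · by_cases h2 : q x = 0
      · exact absurd (by simp [mix, h1, h2]) hx
      · exact hmq x h2
    · exact hmp x h1
  -- The excess of the right side over `GJS` is exactly `(1 + α) D(mix ‖ m)`.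
  have h := relEntropy_nonneg (hp.mix hq hα.le) hm h0
  rw [relEntropy_eq _ _ h0] at h
  rw [GJS_eq_ent hp hq hα, GJS_eq_cross hα hmp hmq]
  nlinarith

/-- `α ↦ GJS(p, q, α) / α` is strictly decreasing. -/
theorem GJS_div_lt {p q : X → ℝ} (hp : IsProb p) (hq : IsProb q) (hne : p ≠ q) {a b : ℝ}
    (ha : 0 < a) (hab : a < b) : GJS p q b / b < GJS p q a / a := by
  have hb := ha.trans hab
  -- The minimizer for the ratio `a` serves as a competitor for the ratio `b`; after division by the
  -- ratio only the coefficient of `D(q ‖ mix)` changes, from `1 / a` to `1 / b`.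
  have h1 := GJS_le hp hq hb (hp.mix hq ha.le) (fun x => mix_ne_zero_left hp hq ha)
    (fun x => mix_ne_zero_right hp hq ha.le)
  have h2 : 0 < relEntropy q (mix p q a) := by
    refine relEntropy_pos hq (hp.mix hq ha.le) (fun x => mix_ne_zero_right hp hq ha.le) ?_
    intro h
    apply hne
    funext x
    have hx := congrFun h x
    unfold mix at hx
    rw [eq_div_iff (by positivity)] at hx
    exact mul_left_cancel₀ ha.ne' (by linarith)
  rw [div_lt_div_iff₀ hb ha, GJS_eq_mix p q a]
  calc GJS p q b * a ≤ (b * relEntropy p (mix p q a) + relEntropy q (mix p q a)) * a := by gcongr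
    _ < (a * relEntropy p (mix p q a) + relEntropy q (mix p q a)) * b := by nlinarith

theorem mul_log_div_mix_le {v m c : ℝ} (hv : 0 ≤ v) (hc : 0 < c) (h : v ≤ c * m) :
    v * Real.log (v / m) ≤ v * Real.log c := by
  rcases hv.eq_or_lt with rfl | hv
  · simp
  have hm : 0 < m := by
    by_contra! hm
    nlinarith
  gcongr
  rwa [div_le_iff₀ hm]

/-- The mixture dominates `α / (1 + α)` times `p` and `1 / (1 + α)` times `q`, which bounds the two
logarithms pointwise; moreover `α log ((1 + α) / α) ≤ 1`. -/
theorem GJS_le_log {p q : X → ℝ} (hp : IsProb p) (hq : IsProb q) {α : ℝ} (hα : 0 < α) :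
    GJS p q α ≤ 1 + Real.log (1 + α) := by
  have h1 : relEntropy p (mix p q α) ≤ Real.log ((1 + α) / α) := by
    calc relEntropy p (mix p q α) ≤ ∑ x, p x * Real.log ((1 + α) / α) := by
          refine Finset.sum_le_sum fun x _ => mul_log_div_mix_le (hp.nonneg x) (by positivity) ?_
          have := hq.nonneg x
          unfold mix
          field_simp
          linarith
      _ = _ := by rw [← Finset.sum_mul, hp.sum_eq_one, one_mul]
  have h2 : relEntropy q (mix p q α) ≤ Real.log (1 + α) := by
    calc relEntropy q (mix p q α) ≤ ∑ x, q x * Real.log (1 + α) := by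
          refine Finset.sum_le_sum fun x _ => mul_log_div_mix_le (hq.nonneg x) (by positivity) ?_
          have := mul_nonneg hα.le (hp.nonneg x)
          unfold mix
          field_simp
          linarith
      _ = _ := by rw [← Finset.sum_mul, hq.sum_eq_one, one_mul]
  have h3 : Real.log ((1 + α) / α) ≤ 1 / α := by
    have := Real.log_le_sub_one_of_pos (show 0 < (1 + α) / α by positivity)
    have e : (1 + α) / α - 1 = 1 / α := by field_simp; ring
    linarith
  have h4 : α * relEntropy p (mix p q α) ≤ 1 := by
    calc α * relEntropy p (mix p q α) ≤ α * (1 / α) := by gcongr; linarith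
      _ = 1 := by field_simp
  rw [GJS_eq_mix]
  linarith

/-! ### Continuity, the Chernoff coefficient and the equation `GJS(p, q, α) = γ α`. -/

theorem continuous_ent : Continuous (ent : (X → ℝ) → ℝ) := by
  unfold ent
  exact continuous_finsetSum _ fun x _ => Real.continuous_negMulLog.comp (continuous_apply x)

/-- The Chernoff coefficient `∑ q(x)^η p(x)^(1 - η)`. -/
def chernoffCoeff (η : ℝ) (q p : X → ℝ) : ℝ := ∑ x, q x ^ η * p x ^ (1 - η)

theorem continuous_chernoffCoeff {η : ℝ} (hη : 0 ≤ η) (p : X → ℝ) :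
    Continuous fun m : X → ℝ => chernoffCoeff η m p := by
  unfold chernoffCoeff
  exact continuous_finsetSum _ fun x _ =>
    ((Real.continuous_rpow_const hη).comp (continuous_apply x)).mul continuous_const

/-- Gibbs' inequality for the unnormalized vector `m^η p^(1-η)`, whose divergence from `p` is `η D(p
‖ m)`. -/
theorem neg_log_chernoffCoeff_le {p m : X → ℝ} (hp : IsProb p) (hm : IsProb m)
    (h : ∀ x, p x ≠ 0 → m x ≠ 0) (η : ℝ) :
    -Real.log (chernoffCoeff η m p) ≤ η * relEntropy p m := by
  have h1 := neg_log_sum_le_relEntropy (q := fun x => m x ^ η * p x ^ (1 - η)) hp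
    (fun x => mul_nonneg (Real.rpow_nonneg (hm.nonneg x) _) (Real.rpow_nonneg (hp.nonneg x) _))
    (fun x hx => by
      have hp' := (hp.nonneg x).lt_of_ne' hx
      have hm' := (hm.nonneg x).lt_of_ne' (h x hx)
      positivity)
  refine h1.trans (le_of_eq ?_)
  unfold relEntropy
  rw [Finset.mul_sum]
  refine Finset.sum_congr rfl fun x _ => ?_
  by_cases hx : p x = 0
  · simp [hx]
  have hp' := (hp.nonneg x).lt_of_ne' hx
  have hm' := (hm.nonneg x).lt_of_ne' (h x hx)
  rw [Real.log_div hx (by positivity), Real.log_mul (by positivity) (by positivity),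
    Real.log_rpow hm', Real.log_rpow hp', Real.log_div hx hm'.ne']
  ring

theorem IsProb.exists_ne_zero {v : X → ℝ} (hv : IsProb v) : ∃ a, v a ≠ 0 := by
  by_contra! hc
  have := hv.sum_eq_one
  simp [hc] at this

theorem chernoffCoeff_pos {p m : X → ℝ} (hp : IsProb p) (hm : IsProb m)
    (h : ∀ x, p x ≠ 0 → m x ≠ 0) (η : ℝ) : 0 < chernoffCoeff η m p := by
  obtain ⟨a, ha⟩ := hp.exists_ne_zero
  have hp' := (hp.nonneg a).lt_of_ne' ha
  have hm' := (hm.nonneg a).lt_of_ne' (h a ha)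
  exact Finset.sum_pos'
    (fun x _ => mul_nonneg (Real.rpow_nonneg (hm.nonneg x) _) (Real.rpow_nonneg (hp.nonneg x) _))
    ⟨a, Finset.mem_univ a, by positivity⟩

/-- The generalized Jensen-Shannon divergence, written with entropies, is jointly continuous. -/
theorem continuousAt_GJS_ent (z : (X → ℝ) × (X → ℝ) × ℝ) (hz : 0 < z.2.2) :
    ContinuousAt (fun z : (X → ℝ) × (X → ℝ) × ℝ =>
      (1 + z.2.2) * ent (mix z.1 z.2.1 z.2.2) - z.2.2 * ent z.1 - ent z.2.1) z := by
  have hm : ContinuousAt (fun z : (X → ℝ) × (X → ℝ) × ℝ => mix z.1 z.2.1 z.2.2) z := by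
    unfold mix
    refine continuousAt_pi.2 fun x => ContinuousAt.div ?_ ?_ (by positivity) <;> fun_prop
  have h1 := continuous_ent.continuousAt.comp hm
  have h2 := (continuous_ent (X := X)).comp
    (continuous_fst : Continuous fun z : (X → ℝ) × (X → ℝ) × ℝ => z.1)
  have h3 := (continuous_ent (X := X)).comp
    (continuous_snd.fst : Continuous fun z : (X → ℝ) × (X → ℝ) × ℝ => z.2.1)
  exact (((by fun_prop : ContinuousAt (fun z : (X → ℝ) × (X → ℝ) × ℝ => 1 + z.2.2) z).mul
    h1).sub ((by fun_prop : ContinuousAt (fun z : (X → ℝ) × (X → ℝ) × ℝ => z.2.2) z).mul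
      h2.continuousAt)).sub h3.continuousAt

theorem continuousOn_GJS {p q : X → ℝ} (hp : IsProb p) (hq : IsProb q) :
    ContinuousOn (GJS p q) (Set.Ioi 0) := by
  refine ContinuousOn.congr (f := fun α => (1 + α) * ent (mix p q α) - α * ent p - ent q) ?_
    fun α hα => GJS_eq_ent hp hq hα
  intro α hα
  have h := continuousAt_GJS_ent (p, q, α) hα
  exact (ContinuousAt.comp (f := fun α : ℝ => (p, q, α)) h (by fun_prop)).continuousWithinAt

theorem chernoffCoeff_self {p : X → ℝ} (hp : IsProb p) {η : ℝ} (hη : 0 < η) :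
    chernoffCoeff η p p = 1 := by
  rw [← hp.sum_eq_one]
  refine Finset.sum_congr rfl fun x _ => ?_
  rcases (hp.nonneg x).eq_or_lt with h | h
  · rw [← h, Real.zero_rpow hη.ne', zero_mul]
  · rw [← Real.rpow_add h]
    simp

theorem ne_of_chernoffCoeff_le {p q : X → ℝ} (hp : IsProb p) {η γ : ℝ} (hη : 0 < η)
    (hγ : 0 < γ) (hC : chernoffCoeff η q p ≤ Real.exp (-γ)) : p ≠ q := by
  rintro rfl
  rw [chernoffCoeff_self hp hη] at hC
  have : Real.exp (-γ) < 1 := by simpa using hγ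
  linarith

/-- As `α → 0` the mixture tends to `q`, so its Chernoff coefficient with `p` falls below `e^{-η
γ}`; here `η < 1` provides the slack. Hence `D(p ‖ mix) > γ`, and `GJS ≥ α D(p ‖ mix)`. -/
theorem exists_GJS_gt {p q : X → ℝ} (hp : IsProb p) (hq : IsProb q) {η γ : ℝ} (hη : 0 < η)
    (hη1 : η < 1) (hγ : 0 < γ) (hC : chernoffCoeff η q p ≤ Real.exp (-γ)) :
    ∀ᶠ α in 𝓝[>] (0 : ℝ), γ * α < GJS p q α := by
  have hlt : chernoffCoeff η q p < Real.exp (-(η * γ)) :=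
    hC.trans_lt (Real.exp_lt_exp.2 (by nlinarith))
  have hm : Tendsto (fun α => mix p q α) (𝓝[>] 0) (𝓝 q) := by
    have : ContinuousAt (fun α => mix p q α) 0 := by
      unfold mix
      refine continuousAt_pi.2 fun x => ContinuousAt.div ?_ ?_ (by norm_num) <;> fun_prop
    have h0 : mix p q 0 = q := by
      funext x
      simp [mix]
    rw [ContinuousAt, h0] at this
    exact this.mono_left nhdsWithin_le_nhds
  have hev := (((continuous_chernoffCoeff hη.le p).tendsto q).comp hm).eventually
    (gt_mem_nhds hlt)
  filter_upwards [hev, self_mem_nhdsWithin] with α h1 (hα : 0 < α)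
  have hmp := fun x => mix_ne_zero_left hp hq hα (x := x)
  have hM := hp.mix hq hα.le
  have h2 := neg_log_chernoffCoeff_le hp hM hmp η
  have h3 := (Real.log_lt_iff_lt_exp (chernoffCoeff_pos hp hM hmp η)).2 h1
  have h4 : γ < relEntropy p (mix p q α) := by
    by_contra! hc
    nlinarith
  have h5 := relEntropy_nonneg hq hM (fun x => mix_ne_zero_right hp hq hα.le)
  rw [GJS_eq_mix]
  nlinarith

theorem exists_GJS_lt {p q : X → ℝ} (hp : IsProb p) (hq : IsProb q) {γ : ℝ} (hγ : 0 < γ) :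
    ∀ᶠ α in atTop, GJS p q α < γ * α := by
  filter_upwards [eventually_gt_atTop 0,
    -- The bound `log u ≤ u - 1` at `u = (γ / 2) (1 + α)` turns `1 + log (1 + α) < γ α` into `γ - 2
    -- log (γ / 2) < γ α`.
    eventually_gt_atTop (1 - 2 * Real.log (γ / 2) / γ)] with α hα h
  refine (GJS_le_log hp hq hα).trans_lt ?_
  have h1 := Real.log_le_sub_one_of_pos (show 0 < γ / 2 * (1 + α) by positivity)
  rw [Real.log_mul (by positivity) (by positivity)] at h1
  have h2 : γ * (1 - 2 * Real.log (γ / 2) / γ) < γ * α := by gcongr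
  have h3 : γ * (1 - 2 * Real.log (γ / 2) / γ) = γ - 2 * Real.log (γ / 2) := by field_simp
  linarith

theorem exists_solution {p q : X → ℝ} (hp : IsProb p) (hq : IsProb q) {η γ : ℝ} (hη : 0 < η)
    (hη1 : η < 1) (hγ : 0 < γ) (hC : chernoffCoeff η q p ≤ Real.exp (-γ)) :
    ∃ β, 0 < β ∧ GJS p q β = γ * β := by
  obtain ⟨a, ha, ha0⟩ := ((exists_GJS_gt hp hq hη hη1 hγ hC).and self_mem_nhdsWithin).exists
  obtain ⟨b, hb, hab⟩ := ((exists_GJS_lt hp hq hγ).and (eventually_ge_atTop a)).exists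
  have ha0 : 0 < a := ha0
  have hc : ContinuousOn (fun α => GJS p q α - γ * α) (Set.Icc a b) :=
    ((continuousOn_GJS hp hq).mono fun x hx => ha0.trans_le hx.1).sub (by fun_prop)
  obtain ⟨β, hβ, h⟩ := intermediate_value_Icc' hab hc
    (show (0 : ℝ) ∈ _ from ⟨by linarith, by linarith⟩)
  exact ⟨β, ha0.trans_le hβ.1, by linarith⟩

theorem lt_GJS_of_lt_solution {p q : X → ℝ} (hp : IsProb p) (hq : IsProb q) (hne : p ≠ q)
    {γ a β : ℝ} (ha : 0 < a) (hab : a < β) (hβ : GJS p q β = γ * β) : γ * a < GJS p q a := by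
  have h := GJS_div_lt hp hq hne ha hab
  rwa [hβ, mul_div_assoc, div_self (ha.trans hab).ne', mul_one, lt_div_iff₀ ha] at h

theorem solution_unique {p q : X → ℝ} (hp : IsProb p) (hq : IsProb q) (hne : p ≠ q)
    {γ a b : ℝ} (ha : 0 < a) (hb : 0 < b) (h1 : GJS p q a = γ * a) (h2 : GJS p q b = γ * b) :
    a = b := by
  rcases lt_trichotomy a b with h | h | h
  · exact absurd h1 (lt_GJS_of_lt_solution hp hq hne ha h h2).ne'
  · exact h
  · exact absurd h2 (lt_GJS_of_lt_solution hp hq hne hb h h1).ne'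

/-! ### Types of words and their number. -/

section Types

variable {n N : ℕ}

theorem sum_word (hn : 0 < n) (x : Fin n → X) (f : X → ℝ) :
    ∑ i, f (x i) = n * ∑ a, empirical x a * f a := by
  classical
  have hn' : (n : ℝ) ≠ 0 := by positivity
  simp only [empirical, mul_assoc, Finset.sum_mul, ite_mul, one_mul, zero_mul]
  rw [← Finset.mul_sum, Finset.sum_comm, ← mul_assoc, mul_one_div_cancel hn', one_mul]
  simp

theorem isProb_empirical (hn : 0 < n) (x : Fin n → X) : IsProb (empirical x) where
  nonneg a := by
    unfold empirical
    exact mul_nonneg (by positivity) (Finset.sum_nonneg fun i _ => by split_ifs <;> norm_num)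
  sum_eq_one := by
    have h := sum_word hn x fun _ => 1
    have hn' : (n : ℝ) ≠ 0 := by positivity
    simp only [Finset.sum_const, Finset.card_univ, Fintype.card_fin, nsmul_eq_mul, mul_one] at h
    exact mul_left_cancel₀ hn' (by linarith)

theorem empirical_pos {A : Type*} (hn : 0 < n) (x : Fin n → A) (i : Fin n) : 0 < empirical x (x i) := by
  unfold empirical
  refine mul_pos (by positivity) (Finset.sum_pos' (fun j _ => by split_ifs <;> norm_num)
    ⟨i, Finset.mem_univ i, by simp⟩)

theorem exists_of_empirical_ne_zero {A : Type*} {x : Fin n → A} {a : A} (h : empirical x a ≠ 0) :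
    ∃ i, x i = a := by
  by_contra! hc
  exact h (by simp [empirical, hc])

theorem prod_word (hn : 0 < n) (x : Fin n → X) {q : X → ℝ} (hq : ∀ i, 0 < q (x i)) :
    ∏ i, q (x i) = Real.exp (n * ∑ a, empirical x a * Real.log (q a)) := by
  rw [← sum_word hn x fun a => Real.log (q a), Real.exp_sum]
  exact Finset.prod_congr rfl fun i _ => (Real.exp_log (hq i)).symm

theorem prod_empirical (hn : 0 < n) (x : Fin n → X) :
    ∏ i, empirical x (x i) = Real.exp (-(n * ent (empirical x))) := by
  rw [prod_word hn x (empirical_pos hn x)]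
  simp [ent, Real.negMulLog]

/-- The number of types is at most `(n + 1) ^ |X|`. -/
theorem sum_exp_ent_le (hn : 0 < n) :
    ∑ x : Fin n → X, Real.exp (-(n * ent (empirical x))) ≤ ((n : ℝ) + 1) ^ Fintype.card X := by
  classical
  -- Candidate types are indexed by count vectors with entries in `0, …, n`. A word has probability
  -- `e^{-n H}` under its own type, and each candidate in `S` has total mass `1` over all words, so
  -- the sum is at most the number of candidates.
  let t : (X → Fin (n + 1)) → X → ℝ := fun c a => 1 / (n : ℝ) * ((c a : ℕ) : ℝ)
  let S : Finset (X → Fin (n + 1)) := {c | ∑ a, t c a = 1}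
  have ht0 : ∀ c a, 0 ≤ t c a := fun c a => by positivity
  have key : ∀ x : Fin n → X,
      Real.exp (-(n * ent (empirical x))) ≤ ∑ c ∈ S, ∏ i, t c (x i) := by
    intro x
    let c : X → Fin (n + 1) := fun a =>
      ⟨({i | x i = a} : Finset (Fin n)).card,
        Nat.lt_succ_of_le ((Finset.card_le_univ _).trans_eq (Fintype.card_fin n))⟩
    have hc : t c = empirical x := by
      funext a
      simp only [t, c, empirical, Finset.sum_boole]
    have hS : c ∈ S := by
      simp only [S, Finset.mem_filter, Finset.mem_univ, true_and, hc]
      exact (isProb_empirical hn x).sum_eq_one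
    calc Real.exp (-(n * ent (empirical x))) = ∏ i, t c (x i) := by
          rw [hc, prod_empirical hn]
      _ ≤ _ := Finset.single_le_sum (f := fun c => ∏ i, t c (x i))
          (fun c _ => Finset.prod_nonneg fun i _ => ht0 c _) hS
  calc _ ≤ ∑ x : Fin n → X, ∑ c ∈ S, ∏ i, t c (x i) := Finset.sum_le_sum fun x _ => key x
    _ = ∑ c ∈ S, ∑ x : Fin n → X, ∏ i, t c (x i) := Finset.sum_comm
    _ = ∑ c ∈ S, (1 : ℝ) := by
        refine Finset.sum_congr rfl fun c hc => ?_
        rw [← Fintype.sum_pow, (Finset.mem_filter.1 hc).2, one_pow]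
    _ ≤ _ := by
        rw [Finset.sum_const, nsmul_one]
        calc (S.card : ℝ) ≤ (Fintype.card (X → Fin (n + 1)) : ℕ) := by
              exact_mod_cast Finset.card_le_univ S
          _ = _ := by simp

end Types

/-! ### Probabilities of words, and the score of two words from one source. -/

/-- The probability of a word of independent letters with law `q`. -/
def wordProb {A : Type*} {n : ℕ} (q : A → ℝ) (x : Fin n → A) : ℝ := ∏ i, q (x i)

open scoped Classical in
/-- The probability of a set of words of independent letters with law `q`. -/
def setProb (q : X → ℝ) (n : ℕ) (B : (Fin n → X) → Prop) : ℝ :=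
  ∑ x, if B x then wordProb q x else 0

open scoped Classical in
/-- The probability of a relation between two independent words, with laws `p` and `q` of the
letters. -/
def pairProb (p q : X → ℝ) (N n : ℕ) (R : (Fin N → X) → (Fin n → X) → Prop) : ℝ :=
  ∑ x, ∑ y, if R x y then wordProb p x * wordProb q y else 0

theorem wordProb_nonneg {q : X → ℝ} (hq : IsProb q) {n : ℕ} (x : Fin n → X) :
    0 ≤ wordProb q x := Finset.prod_nonneg fun _ _ => hq.nonneg _

theorem sum_wordProb {q : X → ℝ} (hq : IsProb q) (n : ℕ) :
    ∑ x : Fin n → X, wordProb q x = 1 := by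
  unfold wordProb
  rw [← Fintype.sum_pow, hq.sum_eq_one, one_pow]

theorem setProb_le_of_forall_exp {q : X → ℝ} {n : ℕ} (hn : 0 < n) {c : ℝ}
    (hc : 0 ≤ c) {B : (Fin n → X) → Prop}
    (hB : ∀ x, B x → wordProb q x ≤ c * Real.exp (-(n * ent (empirical x)))) :
    setProb q n B ≤ c * ((n : ℝ) + 1) ^ Fintype.card X := by
  classical
  refine le_trans ?_ (mul_le_mul_of_nonneg_left (sum_exp_ent_le (X := X) hn) hc)
  rw [Finset.mul_sum]
  refine Finset.sum_le_sum fun x _ => ?_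
  split_ifs with h
  · exact hB x h
  · positivity

theorem pairProb_le_add {p q : X → ℝ} (hp : IsProb p) (hq : IsProb q) {N n : ℕ}
    {R : (Fin N → X) → (Fin n → X) → Prop} {B : (Fin N → X) → Prop} {C : (Fin n → X) → Prop}
    (h : ∀ x y, R x y → B x ∨ C y) : pairProb p q N n R ≤ setProb p N B + setProb q n C := by
  classical
  have e1 : setProb p N B =
      ∑ x, ∑ y : Fin n → X, (if B x then wordProb p x else 0) * wordProb q y := by
    simp_rw [← Finset.mul_sum, sum_wordProb hq, mul_one]
    unfold setProb
    congr!
  have e2 : setProb q n C =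
      ∑ x : Fin N → X, ∑ y, wordProb p x * (if C y then wordProb q y else 0) := by
    simp_rw [← Finset.mul_sum, ← Finset.sum_mul, sum_wordProb hp, one_mul]
    unfold setProb
    congr!
  rw [e1, e2, ← Finset.sum_add_distrib, pairProb]
  refine Finset.sum_le_sum fun x _ => ?_
  rw [← Finset.sum_add_distrib]
  refine Finset.sum_le_sum fun y _ => ?_
  have h1 := wordProb_nonneg hp x
  have h2 := wordProb_nonneg hq y
  have h3 := mul_nonneg h1 h2
  have := h x y
  by_cases hB : B x <;> by_cases hC : C y <;> by_cases hR : R x y <;>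
    simp only [hB, hC, hR, if_true, if_false] <;> first | nlinarith | simp_all

/-- When neither word has a letter of `q`-probability zero, the left side is `exp` of `-N D(V ‖ q) -
n D(W ‖ q) - N H(V) - n H(W)`. The true law `q` is a competitor in the minimum defining the score,
with ratio `N / n`. -/
theorem wordProb_mul_le {q : X → ℝ} (hq : IsProb q) {N n : ℕ} (hN : 0 < N) (hn : 0 < n)
    (x : Fin N → X) (y : Fin n → X) :
    wordProb q x * wordProb q y ≤ Real.exp (-score x y) *
      (Real.exp (-(N * ent (empirical x))) * Real.exp (-(n * ent (empirical y)))) := by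
  by_cases hx : ∃ i, q (x i) = 0
  · obtain ⟨i, hi⟩ := hx
    rw [wordProb, Finset.prod_eq_zero (Finset.mem_univ i) hi, zero_mul]
    positivity
  by_cases hy : ∃ i, q (y i) = 0
  · obtain ⟨i, hi⟩ := hy
    rw [wordProb, wordProb, Finset.prod_eq_zero (s := Finset.univ) (f := fun i => q (y i))
      (Finset.mem_univ i) hi, mul_zero]
    positivity
  push Not at hx hy
  have hα : (0 : ℝ) < N / n := by positivity
  have h := GJS_le (isProb_empirical hN x) (isProb_empirical hn y) hα hq
    (fun a ha => by
      obtain ⟨i, rfl⟩ := exists_of_empirical_ne_zero ha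
      exact hx i)
    (fun a ha => by
      obtain ⟨i, rfl⟩ := exists_of_empirical_ne_zero ha
      exact hy i)
  rw [relEntropy_eq _ q (fun a ha => by
      obtain ⟨i, rfl⟩ := exists_of_empirical_ne_zero ha
      exact hx i), relEntropy_eq _ q (fun a ha => by
      obtain ⟨i, rfl⟩ := exists_of_empirical_ne_zero ha
      exact hy i)] at h
  rw [wordProb, wordProb, prod_word hN x fun i => (hq.nonneg _).lt_of_ne' (hx i),
    prod_word hn y fun i => (hq.nonneg _).lt_of_ne' (hy i), ← Real.exp_add, ← Real.exp_add,
    ← Real.exp_add]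
  refine Real.exp_le_exp.2 ?_
  have h2 := mul_le_mul_of_nonneg_left h (Nat.cast_nonneg (α := ℝ) n)
  rw [mul_add, ← mul_assoc, mul_div_cancel₀ _ (by positivity : (n : ℝ) ≠ 0)] at h2
  unfold score
  linarith

/-- A large score of two words from the same source is unlikely. -/
theorem pairProb_le_score_le {q : X → ℝ} (hq : IsProb q) {N n : ℕ} (hN : 0 < N) (hn : 0 < n)
    (s : ℝ) : pairProb q q N n (fun x y => s ≤ score x y) ≤
      Real.exp (-s) * (((N : ℝ) + 1) ^ Fintype.card X * ((n : ℝ) + 1) ^ Fintype.card X) := by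
  classical
  calc pairProb q q N n (fun x y => s ≤ score x y)
      ≤ ∑ x : Fin N → X, ∑ y : Fin n → X, Real.exp (-s) *
          (Real.exp (-(N * ent (empirical x))) * Real.exp (-(n * ent (empirical y)))) := by
        refine Finset.sum_le_sum fun x _ => Finset.sum_le_sum fun y _ => ?_
        split_ifs with h
        · refine (wordProb_mul_le hq hN hn x y).trans ?_
          gcongr
        · positivity
    _ = Real.exp (-s) * ((∑ x : Fin N → X, Real.exp (-(N * ent (empirical x)))) *
          ∑ y : Fin n → X, Real.exp (-(n * ent (empirical y)))) := by
        rw [Finset.sum_mul_sum, Finset.mul_sum]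
        exact Finset.sum_congr rfl fun x _ => (Finset.mul_sum _ _ _).symm
    _ ≤ _ := by
        gcongr
        · exact sum_exp_ent_le hN
        · exact sum_exp_ent_le hn

/-! ### Concentration of types, and small scores of words from different sources. -/

theorem setProb_le_sum_ge {q : X → ℝ} (hq : IsProb q) (n : ℕ) {f : X → ℝ}
    (hf : ∀ a, |f a| ≤ 1) (h0 : ∑ a, q a * f a = 0) {ε : ℝ} (hε : 0 ≤ ε) (hε2 : ε ≤ 2) :
    setProb q n (fun x => n * ε ≤ ∑ i, f (x i)) ≤ Real.exp (-(n * (ε ^ 2 / 4))) := by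
  classical
  -- Exponential Markov inequality with parameter `ε / 2`. The assumption `ε ≤ 2` keeps the exponent
  -- in `[-1, 1]`, where `e^u ≤ 1 + u + u ^ 2`.
  have hmgf : ∑ a, q a * Real.exp (ε / 2 * f a) ≤ Real.exp (ε ^ 2 / 4) := by
    calc ∑ a, q a * Real.exp (ε / 2 * f a)
        ≤ ∑ a, (q a * (1 + ε ^ 2 / 4) + ε / 2 * (q a * f a)) := by
          refine Finset.sum_le_sum fun a _ => ?_
          have hb : |ε / 2 * f a| ≤ 1 := by
            rw [abs_mul, abs_of_nonneg (by positivity)]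
            calc ε / 2 * |f a| ≤ 1 * 1 := by
                  gcongr
                  · linarith
                  · exact hf a
              _ = 1 := one_mul 1
          have h1 := (abs_le.1 (Real.abs_exp_sub_one_sub_id_le hb)).2
          have h2 : f a ^ 2 ≤ 1 := (sq_le_one_iff_abs_le_one _).2 (hf a)
          have h3 : (ε / 2 * f a) ^ 2 ≤ ε ^ 2 / 4 := by nlinarith [sq_nonneg ε]
          have h4 : Real.exp (ε / 2 * f a) ≤ 1 + ε ^ 2 / 4 + ε / 2 * f a := by linarith
          calc q a * Real.exp (ε / 2 * f a) ≤ q a * (1 + ε ^ 2 / 4 + ε / 2 * f a) :=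
                mul_le_mul_of_nonneg_left h4 (hq.nonneg a)
            _ = _ := by ring
      _ = 1 + ε ^ 2 / 4 := by
          rw [Finset.sum_add_distrib, ← Finset.sum_mul, ← Finset.mul_sum, h0, hq.sum_eq_one]
          ring
      _ ≤ _ := by linarith [Real.add_one_le_exp (ε ^ 2 / 4)]
  calc setProb q n (fun x => n * ε ≤ ∑ i, f (x i))
      ≤ ∑ x : Fin n → X, Real.exp (-(n * (ε ^ 2 / 2))) *
          ∏ i, (q (x i) * Real.exp (ε / 2 * f (x i))) := by
        refine Finset.sum_le_sum fun x _ => ?_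
        rw [Finset.prod_mul_distrib, ← Real.exp_sum, ← Finset.mul_sum]
        have hw := wordProb_nonneg hq x
        change _ ≤ _ * (wordProb q x * _)
        split_ifs with h
        · rw [mul_left_comm, ← Real.exp_add]
          refine le_mul_of_one_le_right hw (Real.one_le_exp ?_)
          have := mul_le_mul_of_nonneg_left h (show 0 ≤ ε / 2 by positivity)
          nlinarith
        · positivity
    _ = Real.exp (-(n * (ε ^ 2 / 2))) * (∑ a, q a * Real.exp (ε / 2 * f a)) ^ n := by
        rw [← Finset.mul_sum, Fintype.sum_pow fun a => q a * Real.exp (ε / 2 * f a)]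
    _ ≤ Real.exp (-(n * (ε ^ 2 / 2))) * Real.exp (ε ^ 2 / 4) ^ n := by
        have : 0 ≤ ∑ a, q a * Real.exp (ε / 2 * f a) :=
          Finset.sum_nonneg fun a _ => mul_nonneg (hq.nonneg a) (Real.exp_pos _).le
        gcongr
    _ = _ := by
        rw [← Real.exp_nat_mul, ← Real.exp_add]
        congr 1
        ring

/-- The type of a word is close to the law of its letters. -/
theorem setProb_far_le {q : X → ℝ} (hq : IsProb q) {n : ℕ} (hn : 0 < n) {ε : ℝ} (hε : 0 ≤ ε)
    (hε2 : ε ≤ 2) : setProb q n (fun x => ∃ a, ε ≤ |empirical x a - q a|) ≤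
      2 * Fintype.card X * Real.exp (-(n * (ε ^ 2 / 4))) := by
  classical
  let f : X → X → ℝ := fun a b => (if b = a then 1 else 0) - q a
  have hf : ∀ a b, |f a b| ≤ 1 := by
    intro a b
    have h1 := hq.nonneg a
    have h2 := hq.le_one a
    simp only [f, abs_le]
    split_ifs <;> constructor <;> linarith
  have hf0 : ∀ a, ∑ b, q b * f a b = 0 := by
    intro a
    simp only [f, mul_sub, Finset.sum_sub_distrib, ← Finset.sum_mul, hq.sum_eq_one]
    simp
  have hsum : ∀ (x : Fin n → X) a, ∑ i, f a (x i) = n * (empirical x a - q a) := by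
    intro x a
    have hn' : (n : ℝ) ≠ 0 := by positivity
    simp only [f, empirical, Finset.sum_sub_distrib, Finset.sum_const, Finset.card_univ,
      Fintype.card_fin, nsmul_eq_mul]
    rw [mul_sub, ← mul_assoc, mul_one_div_cancel hn', one_mul]
  have hpt : ∀ x : Fin n → X, (if ∃ a, ε ≤ |empirical x a - q a| then wordProb q x else 0) ≤
      ∑ a, ((if n * ε ≤ ∑ i, f a (x i) then wordProb q x else 0) +
        (if n * ε ≤ ∑ i, -f a (x i) then wordProb q x else 0)) := by
    intro x
    have hw := wordProb_nonneg hq x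
    have hnn : ∀ a, 0 ≤ (if n * ε ≤ ∑ i, f a (x i) then wordProb q x else 0) +
        (if n * ε ≤ ∑ i, -f a (x i) then wordProb q x else 0) := fun a => by positivity
    split_ifs with h
    · obtain ⟨a, ha⟩ := h
      refine le_trans ?_ (Finset.single_le_sum (fun a _ => hnn a) (Finset.mem_univ a))
      rw [Finset.sum_neg_distrib, hsum]
      rcases le_abs.1 ha with h | h
      · rw [if_pos (mul_le_mul_of_nonneg_left h (Nat.cast_nonneg n))]
        refine le_add_of_nonneg_right ?_
        positivity
      · rw [if_pos (c := (n : ℝ) * ε ≤ -(n * (empirical x a - q a)))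
          (by rw [← mul_neg]; exact mul_le_mul_of_nonneg_left h (Nat.cast_nonneg n))]
        refine le_add_of_nonneg_left ?_
        positivity
    · exact Finset.sum_nonneg fun a _ => hnn a
  calc setProb q n (fun x => ∃ a, ε ≤ |empirical x a - q a|)
      ≤ ∑ x : Fin n → X, ∑ a, ((if n * ε ≤ ∑ i, f a (x i) then wordProb q x else 0) +
        (if n * ε ≤ ∑ i, -f a (x i) then wordProb q x else 0)) := by
        refine Finset.sum_le_sum fun x _ => le_trans (le_of_eq ?_) (hpt x)
        congr!
    _ = ∑ a, (setProb q n (fun x => n * ε ≤ ∑ i, f a (x i)) +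
          setProb q n (fun x => n * ε ≤ ∑ i, -f a (x i))) := by
        rw [Finset.sum_comm]
        refine Finset.sum_congr rfl fun a _ => ?_
        rw [Finset.sum_add_distrib]
        unfold setProb
        congr!
    _ ≤ ∑ a : X, (Real.exp (-(n * (ε ^ 2 / 4))) + Real.exp (-(n * (ε ^ 2 / 4)))) := by
        refine Finset.sum_le_sum fun a _ => add_le_add
          (setProb_le_sum_ge hq n (hf a) (hf0 a) hε hε2)
          (setProb_le_sum_ge hq n (f := fun b => -f a b) (fun b => by rw [abs_neg]; exact hf a b)
            (by simp [hf0]) hε hε2)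
    _ = _ := by
        rw [Finset.sum_const, Finset.card_univ, nsmul_eq_mul]
        ring

/-- A score below `γ N` gives `D(V ‖ mix) < γ`. Gibbs' inequality with the weights `mix^η p^(1-η)`
gives `η D(V ‖ mix) + (1 - η) D(V ‖ p) ≥ γ - δ`, hence `D(V ‖ p) ≥ γ - δ / (1 - η)`. -/
theorem wordProb_le_of_score_lt {p : X → ℝ} (hp : IsProb p) {N n : ℕ} (hN : 0 < N) (hn : 0 < n)
    {η γ δ : ℝ} (hη : 0 < η) (hη1 : η < 1) (x : Fin N → X) (y : Fin n → X)
    (hC : chernoffCoeff η (mix (empirical x) (empirical y) (N / n)) p ≤ Real.exp (-γ + δ))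
    (hs : score x y < γ * N) :
    wordProb p x ≤ Real.exp (-(N * (γ - δ / (1 - η)))) *
      Real.exp (-(N * ent (empirical x))) := by
  by_cases hx : ∃ i, p (x i) = 0
  · obtain ⟨i, hi⟩ := hx
    rw [wordProb, Finset.prod_eq_zero (Finset.mem_univ i) hi]
    positivity
  push Not at hx
  have hx' : ∀ a, empirical x a ≠ 0 → p a ≠ 0 := fun a ha => by
    obtain ⟨i, rfl⟩ := exists_of_empirical_ne_zero ha
    exact hx i
  have hN' : (0 : ℝ) < N := by positivity
  have hn' : (0 : ℝ) < n := by positivity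
  have hα : (0 : ℝ) < N / n := by positivity
  have hV := isProb_empirical hN x
  have hW := isProb_empirical hn y
  set V := empirical x
  set W := empirical y
  have hM := hV.mix hW hα.le
  have hVM := fun a => mix_ne_zero_left hV hW hα (x := a)
  have hpos : ∀ a, V a ≠ 0 → 0 < mix V W (N / n) a := fun a ha =>
    (hM.nonneg a).lt_of_ne' (hVM a ha)
  have hppos : ∀ a, V a ≠ 0 → 0 < p a := fun a ha => (hp.nonneg a).lt_of_ne' (hx' a ha)
  have hG := neg_log_sum_le_relEntropy (q := fun a => mix V W (N / n) a ^ η * p a ^ (1 - η)) hV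
    (fun a => mul_nonneg (Real.rpow_nonneg (hM.nonneg a) _) (Real.rpow_nonneg (hp.nonneg a) _))
    (fun a ha => by
      have := hpos a ha
      have := hppos a ha
      positivity)
  rw [relEntropy_eq _ _ (fun a ha => by
      have := hpos a ha
      have := hppos a ha
      positivity)] at hG
  have hsplit : ∑ a, V a * Real.log (mix V W (N / n) a ^ η * p a ^ (1 - η)) =
      η * ∑ a, V a * Real.log (mix V W (N / n) a) + (1 - η) * ∑ a, V a * Real.log (p a) := by
    rw [Finset.mul_sum, Finset.mul_sum, ← Finset.sum_add_distrib]
    refine Finset.sum_congr rfl fun a _ => ?_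
    by_cases ha : V a = 0
    · simp [ha]
    have h1 := hpos a ha
    have h2 := hppos a ha
    rw [Real.log_mul (by positivity) (by positivity), Real.log_rpow h1, Real.log_rpow h2]
    ring
  rw [hsplit] at hG
  have hlog : Real.log (chernoffCoeff η (mix V W (N / n)) p) ≤ -γ + δ := by
    have hZ : 0 < chernoffCoeff η (mix V W (N / n)) p := by
      obtain ⟨a, ha⟩ := hV.exists_ne_zero
      have := hpos a ha
      have := hppos a ha
      exact Finset.sum_pos' (fun a _ => mul_nonneg (Real.rpow_nonneg (hM.nonneg a) _)
        (Real.rpow_nonneg (hp.nonneg a) _)) ⟨a, Finset.mem_univ a, by positivity⟩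
    exact (Real.log_le_iff_le_exp hZ).2 hC
  -- The nonnegative term `D(W ‖ mix)` of the score is discarded.
  have hsc : -ent V - ∑ a, V a * Real.log (mix V W (N / n) a) < γ := by
    rw [← relEntropy_eq _ _ hVM]
    have h1 := relEntropy_nonneg hW hM (fun a => mix_ne_zero_right hV hW hα.le)
    unfold score at hs
    rw [GJS_eq_mix, mul_add, ← mul_assoc, mul_div_cancel₀ _ hn'.ne'] at hs
    have h2 : N * relEntropy V (mix V W (N / n)) < N * γ := by nlinarith
    exact lt_of_mul_lt_mul_left h2 hN'.le
  have hη' : 0 < 1 - η := by linarith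
  change ∏ i, p (x i) ≤ _
  rw [prod_word hN x fun i => hppos _ (empirical_pos hN x i).ne', ← Real.exp_add]
  refine Real.exp_le_exp.2 ?_
  have hfin : ∑ a, V a * Real.log (p a) ≤ -(γ - δ / (1 - η)) - ent V := by
    have e : -(γ - δ / (1 - η)) - ent V = (-(1 - η) * γ + δ - (1 - η) * ent V) / (1 - η) := by
      field_simp
      ring
    rw [e, le_div_iff₀ hη']
    change -Real.log (chernoffCoeff η (mix V W (N / n)) p) ≤ _ at hG
    nlinarith
  nlinarith

theorem tendsto_pow_mul_exp (k : ℕ) {c : ℝ} (hc : 0 < c) :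
    Tendsto (fun N : ℕ => ((N : ℝ) + 1) ^ k * Real.exp (-(c * N))) atTop (𝓝 0) := by
  have h := (Real.tendsto_pow_mul_exp_neg_atTop_nhds_zero k).comp
    ((tendsto_id.const_mul_atTop hc).comp
      (tendsto_natCast_atTop_atTop.atTop_add (tendsto_const_nhds (x := (1 : ℝ)))))
  have h2 := h.const_mul (Real.exp c / c ^ k)
  rw [mul_zero] at h2
  refine h2.congr fun N => ?_
  simp only [Function.comp, id]
  rw [mul_pow, mul_add, neg_add, Real.exp_add, mul_one, Real.exp_neg c]
  field_simp

theorem abs_mix_sub_le {V W : X → ℝ} (hV : IsProb V) (hW : IsProb W) {α : ℝ} (hα : 0 ≤ α)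
    (a : X) : |mix V W α a - W a| ≤ α := by
  have e : mix V W α a - W a = α * ((V a - W a) / (1 + α)) := by
    unfold mix
    field_simp
    ring
  have h1 : |V a - W a| ≤ 1 := by
    have := hV.nonneg a
    have := hW.nonneg a
    have := hV.le_one a
    have := hW.le_one a
    rw [abs_le]
    constructor <;> linarith
  rw [e, abs_mul, abs_of_nonneg hα, abs_div, abs_of_pos (by positivity : 0 < 1 + α)]
  refine mul_le_of_le_one_right hα ?_
  rw [div_le_one (by positivity)]
  linarith

/-- At time `N ^ 2` the score against the other source is unlikely to be small. -/
theorem eventually_pairProb_sq_le {p q : X → ℝ} (hp : IsProb p) (hq : IsProb q) {η γ δ : ℝ}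
    (hη : 0 < η) (hη1 : η < 1) (hδ : 0 < δ) (hC : chernoffCoeff η q p ≤ Real.exp (-γ)) :
    ∀ᶠ N : ℕ in atTop, pairProb p q N (N ^ 2) (fun x y => score x y < γ * N) ≤
      Real.exp (-(N * (γ - δ))) * ((N : ℝ) + 1) ^ Fintype.card X +
        2 * Fintype.card X * Real.exp (-(γ * N)) := by
  have hη' : 0 < 1 - η := by linarith
  -- The slack `δ (1 - η)` becomes `δ` after the division by `1 - η` in `wordProb_le_of_score_lt`.
  have hlt : chernoffCoeff η q p < Real.exp (-γ + δ * (1 - η)) :=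
    hC.trans_lt (Real.exp_lt_exp.2 (by nlinarith))
  obtain ⟨ε, hε, hball⟩ := Metric.eventually_nhds_iff.1
    (((continuous_chernoffCoeff hη.le p).tendsto q).eventually (gt_mem_nhds hlt))
  set r := min (ε / 2) 1
  have hr : 0 < r := by positivity
  have hr1 : r ≤ 1 := min_le_right _ _
  have hr2 : r ≤ ε / 2 := min_le_left _ _
  filter_upwards [eventually_gt_atTop 0,
    tendsto_natCast_atTop_atTop.eventually_gt_atTop (2 / ε),
    -- With `N ^ 2` test letters the deviation exponent `N ^ 2 r ^ 2 / 4` exceeds `γ N`, however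
    -- small `r` is.
    tendsto_natCast_atTop_atTop.eventually_ge_atTop (γ / (r ^ 2 / 4))] with N hN hN1 hN2
  have hN' : (0 : ℝ) < N := by positivity
  have hn : 0 < N ^ 2 := by positivity
  have hα : (N : ℝ) / ((N ^ 2 : ℕ) : ℝ) = 1 / N := by
    push_cast
    field_simp
  refine (pairProb_le_add hp hq
    (B := fun x => wordProb p x ≤ Real.exp (-(N * (γ - δ))) *
      Real.exp (-(N * ent (empirical x))))
    (C := fun y => ∃ a, r ≤ |empirical y a - q a|) ?_).trans (add_le_add ?_ ?_)
  · intro x y hs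
    by_cases hy : ∃ a, r ≤ |empirical y a - q a|
    · exact Or.inr hy
    left
    push Not at hy
    have hd : dist (mix (empirical x) (empirical y) (N / ((N ^ 2 : ℕ) : ℝ))) q < ε := by
      rw [dist_pi_lt_iff hε]
      intro a
      rw [Real.dist_eq, hα]
      have h1 := abs_mix_sub_le (isProb_empirical hN x) (isProb_empirical hn y)
        (α := 1 / (N : ℝ)) (by positivity) a
      have h2 : 1 / (N : ℝ) < ε / 2 := by
        rw [div_lt_iff₀ hN']
        rw [div_lt_iff₀ hε] at hN1
        linarith
      calc _ ≤ _ := abs_sub_le _ (empirical y a) _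
        _ < ε / 2 + ε / 2 := add_lt_add_of_le_of_lt (h1.trans h2.le) ((hy a).trans_le hr2)
        _ = ε := by ring
    have h := wordProb_le_of_score_lt hp hN hn hη hη1 x y (hball hd).le hs
    rwa [mul_div_cancel_right₀ _ hη'.ne'] at h
  · exact setProb_le_of_forall_exp hN (Real.exp_pos _).le fun x hx => hx
  · refine (setProb_far_le hq hn hr.le (by linarith)).trans ?_
    refine mul_le_mul_of_nonneg_left (Real.exp_le_exp.2 (neg_le_neg ?_)) (by positivity)
    rw [div_le_iff₀ (by positivity)] at hN2
    push_cast
    nlinarith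

/-- At a time `t N` with `t > 1 / β` the score against the other source is unlikely to be
small. -/
theorem exists_pairProb_ceil_le {p q : X → ℝ} (hp : IsProb p) (hq : IsProb q) {γ t : ℝ}
    (ht : 0 < t) (hG : γ * (1 / t) < GJS p q (1 / t)) :
    ∃ c > 0, ∀ᶠ N : ℕ in atTop, 0 < ⌈t * N⌉₊ ∧
      pairProb p q N ⌈t * N⌉₊ (fun x y => score x y < γ * N) ≤
      2 * Fintype.card X * Real.exp (-(c * N)) + 2 * Fintype.card X * Real.exp (-(c * N)) := by
  have ht' : 0 < 1 / t := by positivity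
  rw [GJS_eq_ent hp hq ht'] at hG
  have hcont := (continuousAt_GJS_ent (p, q, 1 / t) ht').sub
    (g := fun z : (X → ℝ) × (X → ℝ) × ℝ => γ * z.2.2) (by fun_prop)
  obtain ⟨ε, hε, hball⟩ := Metric.eventually_nhds_iff.1
    (hcont.eventually (lt_mem_nhds (sub_pos.2 hG)))
  set r := min (ε / 2) 1
  have hr : 0 < r := by positivity
  have hr1 : r ≤ 1 := min_le_right _ _
  have hr2 : r < ε := (min_le_left _ _).trans_lt (by linarith)
  have hlim : Tendsto (fun N : ℕ => (N : ℝ) / (⌈t * N⌉₊ : ℝ)) atTop (𝓝 (1 / t)) := by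
    have h := ((tendsto_nat_ceil_mul_div_atTop ht.le).comp
      (tendsto_natCast_atTop_atTop (R := ℝ))).inv₀ ht.ne'
    rw [one_div]
    refine h.congr fun N => ?_
    simp only [Function.comp, inv_div]
  -- The two words have lengths `N` and at least `t N`; the factor `min 1 t` serves both.
  refine ⟨min 1 t * (r ^ 2 / 4), by positivity, ?_⟩
  filter_upwards [eventually_gt_atTop 0, hlim.eventually (Metric.ball_mem_nhds _ hε)]
    with N hN hdist
  have hN' : (0 : ℝ) < N := by positivity
  have hn : 0 < ⌈t * N⌉₊ := Nat.ceil_pos.2 (by positivity)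
  have hn' : (0 : ℝ) < ⌈t * N⌉₊ := by positivity
  have hge : t * N ≤ ⌈t * N⌉₊ := Nat.le_ceil _
  have hα : 0 < (N : ℝ) / ⌈t * N⌉₊ := by positivity
  refine ⟨hn, (pairProb_le_add hp hq
    (B := fun x => ∃ a, r ≤ |empirical x a - p a|)
    (C := fun y => ∃ a, r ≤ |empirical y a - q a|) ?_).trans (add_le_add ?_ ?_)⟩
  · intro x y hs
    by_contra! hfar
    have h := hball (y := (empirical x, empirical y, (N : ℝ) / ⌈t * N⌉₊)) (by
      rw [Prod.dist_eq, Prod.dist_eq, max_lt_iff, max_lt_iff]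
      refine ⟨?_, ?_, hdist⟩ <;> rw [dist_pi_lt_iff hε] <;> intro a
      · exact (hfar.1 a).trans hr2
      · exact (hfar.2 a).trans hr2)
    simp only [Pi.sub_apply] at h
    rw [← GJS_eq_ent (isProb_empirical hN x) (isProb_empirical hn y) hα, sub_pos] at h
    have h2 := mul_lt_mul_of_pos_left h hn'
    rw [mul_left_comm, mul_div_cancel₀ _ hn'.ne'] at h2
    exact absurd hs h2.le.not_gt
  · refine (setProb_far_le hp hN hr.le (by linarith)).trans ?_
    refine mul_le_mul_of_nonneg_left (Real.exp_le_exp.2 (neg_le_neg ?_)) (by positivity)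
    rw [mul_comm (N : ℝ)]
    gcongr
    exact mul_le_of_le_one_left (by positivity) (min_le_left _ _)
  · refine (setProb_far_le hq hn hr.le (by linarith)).trans ?_
    refine mul_le_mul_of_nonneg_left (Real.exp_le_exp.2 (neg_le_neg ?_)) (by positivity)
    calc min 1 t * (r ^ 2 / 4) * N ≤ t * (r ^ 2 / 4) * N := by
          gcongr
          exact min_le_right _ _
      _ = t * N * (r ^ 2 / 4) := by ring
      _ ≤ _ := by gcongr

theorem ofReal_sq_mul (N : ℕ) (z : ℝ) :
    ENNReal.ofReal ((N : ℝ) ^ 2 * z) = (N : ℝ≥0∞) ^ 2 * ENNReal.ofReal z := by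
  rw [ENNReal.ofReal_mul (by positivity), ENNReal.ofReal_pow (by positivity),
    ENNReal.ofReal_natCast]

/-! ### Error probability, expected time and their quotient. -/

section Exponent

variable {p q : X → ℝ} {η γ β : ℝ} {Err ET : ℕ → ℝ≥0∞}

theorem eventually_err_le (hp : IsProb p) (hq : IsProb q) (hη : 0 < η) (hη1 : η < 1)
    (hC : chernoffCoeff η q p ≤ Real.exp (-γ))
    (hErr : ∀ N, 0 < N → Err N ≤
      ∑ n ∈ Finset.Icc 1 (N ^ 2),
        ENNReal.ofReal (pairProb q q N n fun x y => γ * N ≤ score x y) +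
      ENNReal.ofReal (pairProb p q N (N ^ 2) fun x y => score x y < γ * N))
    {δ : ℝ} (hδ : 0 < δ) :
    ∀ᶠ N : ℕ in atTop, Err N ≤ ENNReal.ofReal (Real.exp (-(N * (γ - δ)))) := by
  set k := Fintype.card X
  -- The degree counts `k` for the training type, `2 k` for the test type (as `n + 1 ≤ (N + 1) ^
  -- 2`), and `2` for the number of times. Half of `δ` is kept to absorb the polynomial.
  have hlim := (tendsto_pow_mul_exp (3 * k + 2) (half_pos hδ)).const_mul (2 + 2 * (k : ℝ))
  rw [mul_zero] at hlim
  filter_upwards [eventually_gt_atTop 0, hlim.eventually (gt_mem_nhds one_pos),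
    eventually_pairProb_sq_le hp hq hη hη1 (half_pos hδ) hC] with N hN h1 h2
  have hN1 : (1 : ℝ) ≤ (N : ℝ) + 1 := by simp
  have hE1 : Real.exp (-(γ * N)) ≤
      Real.exp (-(N * (γ - δ))) * Real.exp (-(δ / 2 * N)) := by
    rw [← Real.exp_add]
    refine Real.exp_le_exp.2 ?_
    have : 0 ≤ δ * N := by positivity
    nlinarith
  have hE2 : Real.exp (-(N * (γ - δ / 2))) =
      Real.exp (-(N * (γ - δ))) * Real.exp (-(δ / 2 * N)) := by
    rw [← Real.exp_add]
    congr 1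
    ring
  set E := Real.exp (-(N * (γ - δ)))
  set e := Real.exp (-(δ / 2 * N))
  have hE0 : 0 < E := Real.exp_pos _
  have he0 : 0 < e := Real.exp_pos _
  set M := ((N : ℝ) + 1) ^ (3 * k + 2)
  have hkM : ((N : ℝ) + 1) ^ k ≤ M := pow_le_pow_right₀ hN1 (by omega)
  have h1M : 1 ≤ M := one_le_pow₀ hN1
  have hsum : ∀ n ∈ Finset.Icc 1 (N ^ 2),
      pairProb q q N n (fun x y => γ * N ≤ score x y) ≤ E * e * ((N : ℝ) + 1) ^ (3 * k) := by
    intro n hn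
    rw [Finset.mem_Icc] at hn
    refine (pairProb_le_score_le hq hN hn.1 _).trans ?_
    have hn2 : (n : ℝ) + 1 ≤ ((N : ℝ) + 1) ^ 2 := by
      have : (n : ℝ) ≤ (N : ℝ) ^ 2 := by exact_mod_cast hn.2
      have : (0 : ℝ) ≤ N := by positivity
      nlinarith
    calc _ ≤ E * e * (((N : ℝ) + 1) ^ k * (((N : ℝ) + 1) ^ 2) ^ k) := by gcongr
      _ = _ := by rw [← pow_mul, ← pow_add]; congr 2; ring
  calc Err N ≤ _ := hErr N hN
    _ ≤ ∑ n ∈ Finset.Icc 1 (N ^ 2), ENNReal.ofReal (E * e * ((N : ℝ) + 1) ^ (3 * k)) +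
        ENNReal.ofReal (E * e * M + 2 * k * (E * e)) := by
        gcongr with n hn
        · exact hsum n hn
        · refine h2.trans ?_
          rw [hE2]
          gcongr
    _ = ENNReal.ofReal ((N : ℝ) ^ 2 * (E * e * ((N : ℝ) + 1) ^ (3 * k)) +
        (E * e * M + 2 * k * (E * e))) := by
        rw [Finset.sum_const, Nat.card_Icc, Nat.add_sub_cancel, nsmul_eq_mul, Nat.cast_pow,
          ← ofReal_sq_mul, ← ENNReal.ofReal_add (by positivity) (by positivity)]
    _ ≤ ENNReal.ofReal E := by
        refine ENNReal.ofReal_le_ofReal ?_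
        have hA : (N : ℝ) ^ 2 * ((N : ℝ) + 1) ^ (3 * k) ≤ M := by
          calc (N : ℝ) ^ 2 * ((N : ℝ) + 1) ^ (3 * k)
              ≤ ((N : ℝ) + 1) ^ 2 * ((N : ℝ) + 1) ^ (3 * k) := by
                gcongr
                linarith
            _ = M := by ring
        calc _ = E * e * ((N : ℝ) ^ 2 * ((N : ℝ) + 1) ^ (3 * k) + M + 2 * k * 1) := by ring
          _ ≤ E * e * (M + M + 2 * k * M) := by gcongr
          _ = E * ((2 + 2 * k) * (M * e)) := by ring
          _ ≤ E * 1 := by gcongr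
          _ = E := mul_one E

theorem eventually_expectedTime_le (hp : IsProb p) (hq : IsProb q) {t : ℝ} (ht : 0 < t)
    (hG : γ * (1 / t) < GJS p q (1 / t))
    (hET : ∀ N n, 0 < n → ET N ≤ n + (N : ℝ≥0∞) ^ 2 *
      ENNReal.ofReal (pairProb p q N n fun x y => score x y < γ * N)) :
    ∀ᶠ N : ℕ in atTop, ET N ≤ ENNReal.ofReal (t * N + 2) := by
  obtain ⟨c, hc, hev⟩ := exists_pairProb_ceil_le hp hq ht hG
  have hlim := (tendsto_pow_mul_exp 2 hc).const_mul (4 * (Fintype.card X : ℝ))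
  rw [mul_zero] at hlim
  filter_upwards [hev, hlim.eventually (gt_mem_nhds one_pos)] with N h1 h2
  have hceil : (⌈t * N⌉₊ : ℝ) ≤ t * N + 1 := (Nat.ceil_lt_add_one (by positivity)).le
  calc ET N ≤ _ := hET N _ h1.1
    _ ≤ ENNReal.ofReal (t * N + 1) + (N : ℝ≥0∞) ^ 2 *
        ENNReal.ofReal (4 * Fintype.card X * Real.exp (-(c * N))) := by
        gcongr
        · rw [← ENNReal.ofReal_natCast]
          exact ENNReal.ofReal_le_ofReal hceil
        · exact h1.2.trans (le_of_eq (by ring))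
    _ = ENNReal.ofReal (t * N + 1 + N ^ 2 * (4 * Fintype.card X * Real.exp (-(c * N)))) := by
        rw [← ofReal_sq_mul, ← ENNReal.ofReal_add (by positivity) (by positivity)]
    _ ≤ _ := by
        refine ENNReal.ofReal_le_ofReal ?_
        have : (N : ℝ) ^ 2 * (4 * Fintype.card X * Real.exp (-(c * N))) ≤ 1 := by
          calc (N : ℝ) ^ 2 * (4 * Fintype.card X * Real.exp (-(c * N)))
              ≤ ((N : ℝ) + 1) ^ 2 * (4 * Fintype.card X * Real.exp (-(c * N))) := by
                gcongr
                linarith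
            _ = _ := by ring
            _ ≤ 1 := h2.le
        linarith

theorem tendsto_err (hγ : 0 < γ)
    (hErr : ∀ δ > 0, ∀ᶠ N : ℕ in atTop, Err N ≤ ENNReal.ofReal (Real.exp (-(N * (γ - δ))))) :
    Tendsto Err atTop (𝓝 0) := by
  have hlim : Tendsto (fun N : ℕ => ENNReal.ofReal (Real.exp (-(N * (γ - γ / 2))))) atTop
      (𝓝 0) := by
    rw [← ENNReal.ofReal_zero]
    refine ENNReal.tendsto_ofReal ((tendsto_pow_mul_exp 0 (half_pos hγ)).congr fun N => ?_)
    rw [pow_zero, one_mul]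
    congr 1
    ring
  exact tendsto_of_tendsto_of_tendsto_of_le_of_le' tendsto_const_nhds hlim
    (Eventually.of_forall fun _ => zero_le) (hErr _ (half_pos hγ))

theorem le_liminf_exponent (hγ : 0 < γ) (hβ : 0 < β)
    (hErr : ∀ δ > 0, ∀ᶠ N : ℕ in atTop, Err N ≤ ENNReal.ofReal (Real.exp (-(N * (γ - δ)))))
    (hET : ∀ t, 1 / β < t → ∀ᶠ N : ℕ in atTop, ET N ≤ ENNReal.ofReal (t * N + 2))
    (hET1 : ∀ N, 0 < N → 1 ≤ ET N) :
    ((γ * β : ℝ) : EReal) ≤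
      liminf (fun N => -ENNReal.log (Err N) / ((ET N : ℝ≥0∞) : EReal)) atTop := by
  refine le_of_forall_lt fun b hb => ?_
  have hpos : ((0 : ℝ) : EReal) < ((γ * β : ℝ) : EReal) := by
    exact_mod_cast mul_pos hγ hβ
  -- The maximum with `0` makes the intermediate level `c` positive.
  obtain ⟨c, hbc, hc⟩ := EReal.lt_iff_exists_real_btwn.1 (max_lt hb hpos)
  have hc0 : 0 < c := by exact_mod_cast (le_max_right _ _).trans_lt hbc
  have hcβ : c < γ * β := by exact_mod_cast hc
  refine ((le_max_left _ _).trans_lt hbc).trans_le ?_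
  -- A `t` in this gap has `t c < γ`; then `δ < γ - t c` leaves a linear margin `(γ - δ - t c) N`,
  -- which eventually absorbs the constant `2 c`.
  have hlt : 1 / β < γ / c := by
    rw [div_lt_div_iff₀ hβ hc0]
    linarith
  obtain ⟨t, ht1, ht2⟩ := exists_between hlt
  rw [lt_div_iff₀ hc0] at ht2
  have ht0 : 0 < t := (by positivity : 0 < 1 / β).trans ht1
  obtain ⟨δ, hδ, hδ2⟩ := exists_between (sub_pos.2 ht2)
  have hgap : 0 < γ - δ - t * c := by linarith
  refine le_liminf_of_le (by isBoundedDefault) ?_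
  filter_upwards [hErr δ hδ, hET t ht1, eventually_gt_atTop 0,
    tendsto_natCast_atTop_atTop.eventually_ge_atTop (2 * c / (γ - δ - t * c))]
    with N h1 h2 hN h3
  rw [div_le_iff₀ hgap] at h3
  have hnum : ((N * (γ - δ) : ℝ) : EReal) ≤ -ENNReal.log (Err N) := by
    have := ENNReal.log_le_log h1
    rw [ENNReal.log_ofReal_of_pos (Real.exp_pos _), Real.log_exp, EReal.coe_neg] at this
    exact EReal.le_neg_of_le_neg this
  have hden : ((ET N : ℝ≥0∞) : EReal) ≤ ((t * N + 2 : ℝ) : EReal) := by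
    have := EReal.coe_ennreal_le_coe_ennreal_iff.2 h2
    rwa [EReal.coe_ennreal_ofReal, max_eq_left (by positivity)] at this
  have hden0 : (0 : EReal) < ((ET N : ℝ≥0∞) : EReal) := by
    have := EReal.coe_ennreal_le_coe_ennreal_iff.2 (hET1 N hN)
    exact lt_of_lt_of_le (by simp) this
  rw [EReal.le_div_iff_mul_le hden0 (hden.trans_lt (EReal.coe_lt_top _)).ne]
  calc (c : EReal) * ((ET N : ℝ≥0∞) : EReal) ≤ (c : EReal) * ((t * N + 2 : ℝ) : EReal) :=
        mul_le_mul_of_nonneg_left hden (by exact_mod_cast hc0.le)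
    _ = ((c * (t * N + 2) : ℝ) : EReal) := (EReal.coe_mul _ _).symm
    _ ≤ ((N * (γ - δ) : ℝ) : EReal) := by
        refine EReal.coe_le_coe_iff.2 ?_
        linarith
    _ ≤ _ := hnum

end Exponent

/-! ### From the Chernoff information to an interior exponent. -/

theorem sum_rpow_eq_chernoffCoeff (P Q : PMF X) {η : ℝ} (h0 : 0 ≤ η) (h1 : η ≤ 1) :
    ∑ x, P x ^ η * Q x ^ (1 - η) =
      ENNReal.ofReal (chernoffCoeff η (pmfReal P) (pmfReal Q)) := by
  have h1' : 0 ≤ 1 - η := by linarith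
  unfold chernoffCoeff pmfReal
  rw [ENNReal.ofReal_sum_of_nonneg fun x _ => by positivity]
  refine Finset.sum_congr rfl fun x _ => ?_
  rw [ENNReal.ofReal_mul (by positivity), ENNReal.toReal_rpow, ENNReal.toReal_rpow,
    ENNReal.ofReal_toReal (ENNReal.rpow_ne_top_of_nonneg h0 (P.apply_ne_top x)),
    ENNReal.ofReal_toReal (ENNReal.rpow_ne_top_of_nonneg h1' (Q.apply_ne_top x))]

theorem lt_coeff_of_lt_log {c z : ℝ} (h : Real.exp (-c) < z) :
    ((-c : ℝ) : EReal) < ENNReal.log (ENNReal.ofReal z) := by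
  have hz := (Real.exp_pos _).trans h
  rw [ENNReal.log_ofReal_of_pos hz, EReal.coe_lt_coe_iff]
  exact (Real.lt_log_iff_exp_lt hz).2 h

/-- Equality of supports matters at the endpoints: since `0 ^ 0 = 1`, a letter charged by only one
of the laws would make its term jump there. -/
theorem continuousOn_chernoffCoeff_exponent {p q : X → ℝ} (h : ∀ x, p x = 0 ↔ q x = 0) :
    ContinuousOn (fun η => chernoffCoeff η p q) (Set.Icc 0 1) := by
  unfold chernoffCoeff
  refine continuousOn_finsetSum _ fun x _ => ?_
  by_cases hx : p x = 0
  · refine (continuousOn_const (c := (0 : ℝ))).congr fun η _ => ?_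
    simp only [hx, (h x).1 hx]
    by_cases hη : η = 0
    · simp [hη]
    · simp [Real.zero_rpow hη]
  · have hy := mt (h x).2 hx
    exact ((Real.continuous_const_rpow hx).mul
      ((Real.continuous_const_rpow hy).comp (by fun_prop))).continuousOn

/-- A Chernoff bound at level `γ` is attained at an exponent in the open interval `(0, 1)`. -/
theorem exists_chernoffCoeff_le (P Q : PMF X) {γ : ℝ} (hγ : 0 < γ)
    (hγC : (γ : EReal) ≤ chernoff P Q)
    (hsupp : (γ : EReal) = chernoff P Q → P.support = Q.support) :
    ∃ η, 0 < η ∧ η < 1 ∧ chernoffCoeff η (pmfReal P) (pmfReal Q) ≤ Real.exp (-γ) := by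
  -- At both endpoints the coefficient equals `1 > e^{-γ}`, so any such exponent is interior.
  suffices h : ∃ η ∈ Set.Icc (0 : ℝ) 1,
      chernoffCoeff η (pmfReal P) (pmfReal Q) ≤ Real.exp (-γ) by
    obtain ⟨η, hη, hC⟩ := h
    have hlt : Real.exp (-γ) < 1 := by simpa using hγ
    have hne : chernoffCoeff η (pmfReal P) (pmfReal Q) ≠ 1 := by linarith
    refine ⟨η, hη.1.lt_of_ne ?_, hη.2.lt_of_ne ?_, hC⟩
    · rintro rfl
      simp [chernoffCoeff, (isProb_pmfReal Q).sum_eq_one] at hne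
    · rintro rfl
      simp [chernoffCoeff, (isProb_pmfReal P).sum_eq_one] at hne
  by_contra! hc
  have hle : ∀ η ∈ Set.Icc (0 : ℝ) 1,
      ((-γ : ℝ) : EReal) < ENNReal.log (∑ x, P x ^ η * Q x ^ (1 - η)) := fun η hη => by
    rw [sum_rpow_eq_chernoffCoeff P Q hη.1 hη.2]
    exact lt_coeff_of_lt_log (hc η hη)
  -- If no exponent works then `γ` equals the Chernoff information, so the supports agree and the
  -- minimum is attained; being above `e^{-γ}`, it makes the information strictly smaller than `γ`.
  have hge : chernoff P Q ≤ (γ : EReal) := by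
    unfold chernoff
    refine EReal.neg_le_of_neg_le ?_
    rw [← EReal.coe_neg]
    exact le_iInf₂ fun η hη => (hle η hη).le
  have hs := hsupp (le_antisymm hγC hge)
  have hiff : ∀ x, pmfReal P x = 0 ↔ pmfReal Q x = 0 := by
    intro x
    have hx : x ∈ P.support ↔ x ∈ Q.support := by rw [hs]
    rw [PMF.mem_support_iff, PMF.mem_support_iff, not_iff_not] at hx
    simp [pmfReal, ENNReal.toReal_eq_zero_iff, P.apply_ne_top, Q.apply_ne_top, hx]
  obtain ⟨η₀, hη₀, hmin⟩ := isCompact_Icc.exists_isMinOn (Set.nonempty_Icc.2 zero_le_one)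
    (continuousOn_chernoffCoeff_exponent hiff)
  have hinf : ENNReal.log (ENNReal.ofReal (chernoffCoeff η₀ (pmfReal P) (pmfReal Q))) ≤
      ⨅ η ∈ Set.Icc (0 : ℝ) 1, ENNReal.log (∑ x, P x ^ η * Q x ^ (1 - η)) := by
    refine le_iInf₂ fun η hη => ?_
    rw [sum_rpow_eq_chernoffCoeff P Q hη.1 hη.2]
    exact ENNReal.log_le_log (ENNReal.ofReal_le_ofReal (hmin hη))
  have h1 := (lt_coeff_of_lt_log (hc η₀ hη₀)).trans_le hinf
  rw [EReal.coe_neg] at h1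
  exact absurd hγC (EReal.neg_lt_of_neg_lt h1).not_ge

theorem chernoffCoeff_symm (η : ℝ) (p q : X → ℝ) :
    chernoffCoeff (1 - η) p q = chernoffCoeff η q p := by
  unfold chernoffCoeff
  refine Finset.sum_congr rfl fun x _ => ?_
  rw [sub_sub_cancel, mul_comm]

/-! ### Transfer from the joint law to finite sums over words. -/

section Law

theorem prod_pmf {A : Type*} (P : PMF A) {n : ℕ} (w : Fin n → A) :
    ∏ i, P (w i) = ENNReal.ofReal (wordProb (pmfReal P) w) := by
  unfold wordProb pmfReal
  rw [ENNReal.ofReal_prod_of_nonneg fun i _ => ENNReal.toReal_nonneg]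
  exact Finset.prod_congr rfl fun i _ => (ENNReal.ofReal_toReal (P.apply_ne_top _)).symm

/-- Subadditivity over the finitely many pairs of words; only an upper bound is needed, so no
measurability of `f` or `g` enters. -/
theorem measure_le_ofReal_pairProb (P Q : PMF X) (N n : ℕ) (R : (Fin N → X) → (Fin n → X) → Prop)
    {Ω : Type*} [MeasurableSpace Ω] (μ : Measure Ω) (f : Ω → Fin N → X) (g : Ω → Fin n → X)
    (h : ∀ x y, μ {ω | f ω = x ∧ g ω = y} =
      ENNReal.ofReal (wordProb (pmfReal P) x) * ENNReal.ofReal (wordProb (pmfReal Q) y)) :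
    μ {ω | R (f ω) (g ω)} ≤ ENNReal.ofReal (pairProb (pmfReal P) (pmfReal Q) N n R) := by
  classical
  have hP := isProb_pmfReal P
  have hQ := isProb_pmfReal Q
  have hnn : ∀ (x : Fin N → X) (y : Fin n → X),
      0 ≤ if R x y then wordProb (pmfReal P) x * wordProb (pmfReal Q) y else 0 := fun x y => by
    have := wordProb_nonneg hP x
    have := wordProb_nonneg hQ y
    positivity
  have hsub : {ω | R (f ω) (g ω)} ⊆ ⋃ x ∈ (Finset.univ : Finset (Fin N → X)),
      ⋃ y ∈ (Finset.univ : Finset (Fin n → X)), {ω | R x y ∧ f ω = x ∧ g ω = y} := by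
    intro ω hω
    simp only [Finset.mem_univ, Set.iUnion_true, Set.mem_iUnion, Set.mem_ofPred_eq]
    exact ⟨f ω, g ω, hω, rfl, rfl⟩
  calc μ {ω | R (f ω) (g ω)} ≤ _ := measure_mono hsub
    _ ≤ ∑ x, μ (⋃ y ∈ (Finset.univ : Finset (Fin n → X)), {ω | R x y ∧ f ω = x ∧ g ω = y}) :=
        measure_biUnion_finset_le _ _
    _ ≤ ∑ x, ∑ y, μ {ω | R x y ∧ f ω = x ∧ g ω = y} :=
        Finset.sum_le_sum fun x _ => measure_biUnion_finset_le _ _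
    _ ≤ _ := by
        unfold pairProb
        rw [ENNReal.ofReal_sum_of_nonneg fun x _ => Finset.sum_nonneg fun y _ => by
          convert hnn x y]
        refine Finset.sum_le_sum fun x _ => ?_
        rw [ENNReal.ofReal_sum_of_nonneg fun y _ => by convert hnn x y]
        refine Finset.sum_le_sum fun y _ => ?_
        by_cases hR : R x y
        · rw [if_pos hR, ENNReal.ofReal_mul (wordProb_nonneg hP x), ← h]
          simp [hR]
        · simp [hR]

variable [MeasurableSpace X] [MeasurableSingletonClass X]

theorem pi_word {A : Type*} [MeasurableSpace A] [MeasurableSingletonClass A] (P : PMF A) {n : ℕ}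
    (w : Fin n → A) :
    (Measure.pi fun _ : Fin n => P.toMeasure) {w} =
      ENNReal.ofReal (wordProb (pmfReal P) w) := by
  rw [Measure.pi_singleton, ← prod_pmf]
  exact Finset.prod_congr rfl fun i _ =>
    P.toMeasure_apply_singleton _ (measurableSet_singleton _)

theorem infinitePi_initial (P : PMF X) {n : ℕ} (w : Fin n → X) :
    (Measure.infinitePi fun _ : ℕ => P.toMeasure) {y | initial n y = w} =
      ENNReal.ofReal (wordProb (pmfReal P) w) := by
  have hset : {y : ℕ → X | initial n y = w} =
      Set.pi (Finset.range n : Finset ℕ)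
        (fun k => if h : k < n then {w ⟨k, h⟩} else Set.univ) := by
    ext y
    simp only [Set.mem_ofPred_eq, Set.mem_pi, Finset.coe_range, Set.mem_Iio, initial, funext_iff]
    refine ⟨fun h k hk => ?_, fun h k => ?_⟩
    · rw [dif_pos hk]
      exact h ⟨k, hk⟩
    · have := h k k.2
      rwa [dif_pos k.2] at this
  rw [hset, Measure.infinitePi_pi, ← prod_pmf, Finset.prod_range]
  · refine Finset.prod_congr rfl fun i _ => ?_
    rw [dif_pos i.2]
    exact P.toMeasure_apply_singleton _ (measurableSet_singleton _)
  · intro k _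
    exact (Set.toFinite _).measurableSet

theorem law_first_le (P₁ P₂ : PMF X) (i : Hyp) (N n : ℕ)
    (R : (Fin N → X) → (Fin n → X) → Prop) :
    law P₁ P₂ i N {ω | R ω.1 (initial n ω.2.2)} ≤
      ENNReal.ofReal (pairProb (pmfReal P₁) (pmfReal (i.source P₁ P₂)) N n R) := by
  refine measure_le_ofReal_pairProb P₁ (i.source P₁ P₂) N n R (law P₁ P₂ i N) (fun ω => ω.1)
    (fun ω => initial n ω.2.2) fun x y => ?_
  have : {ω : (Fin N → X) × (Fin N → X) × (ℕ → X) | ω.1 = x ∧ initial n ω.2.2 = y} =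
      {x} ×ˢ (Set.univ ×ˢ {z | initial n z = y}) := by
    ext ω
    simp
  rw [this, law, Measure.prod_prod, Measure.prod_prod, measure_univ, one_mul, pi_word,
    infinitePi_initial]

theorem law_second_le (P₁ P₂ : PMF X) (i : Hyp) (N n : ℕ)
    (R : (Fin N → X) → (Fin n → X) → Prop) :
    law P₁ P₂ i N {ω | R ω.2.1 (initial n ω.2.2)} ≤
      ENNReal.ofReal (pairProb (pmfReal P₂) (pmfReal (i.source P₁ P₂)) N n R) := by
  refine measure_le_ofReal_pairProb P₂ (i.source P₁ P₂) N n R (law P₁ P₂ i N) (fun ω => ω.2.1)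
    (fun ω => initial n ω.2.2) fun x y => ?_
  have : {ω : (Fin N → X) × (Fin N → X) × (ℕ → X) | ω.2.1 = x ∧ initial n ω.2.2 = y} =
      Set.univ ×ˢ ({x} ×ˢ {z | initial n z = y}) := by
    ext ω
    simp
  rw [this, law, Measure.prod_prod, Measure.prod_prod, measure_univ, one_mul, pi_word,
    infinitePi_initial]

instance isProbabilityMeasure_law (P₁ P₂ : PMF X) (i : Hyp) (N : ℕ) :
    IsProbabilityMeasure (law P₁ P₂ i N) := by
  unfold law
  infer_instance

end Law

/-! ### The stopping time: crossing events and expectation. -/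

section Time

variable {N : ℕ} {γ : ℝ}

theorem seqTime_swap (γ : ℝ) (x₁ x₂ : Fin N → X) (y : ℕ → X) :
    seqTime γ x₁ x₂ y = seqTime γ x₂ x₁ y := by
  simp only [seqTime, crossings, or_comm]

theorem seqTime_le_sq (x₁ x₂ : Fin N → X) (y : ℕ → X) : seqTime γ x₁ x₂ y ≤ N ^ 2 :=
  Nat.sInf_le (Set.mem_insert _ _)

theorem one_le_seqTime (hN : 0 < N) (x₁ x₂ : Fin N → X) (y : ℕ → X) :
    1 ≤ seqTime γ x₁ x₂ y := by
  rcases Nat.sInf_mem (Set.insert_nonempty (N ^ 2) (crossings γ x₁ x₂ y)) with h | h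
  · rw [seqTime, h]
    exact Nat.one_le_iff_ne_zero.2 (by positivity)
  · exact h.1

theorem seqTime_le_of_score_right {n : ℕ} (hn : 0 < n) {x₁ x₂ : Fin N → X} {y : ℕ → X}
    (h : γ * N ≤ score x₂ (initial n y)) : seqTime γ x₁ x₂ y ≤ n :=
  Nat.sInf_le (Set.mem_insert_of_mem _ ⟨hn, Or.inr h⟩)

/-- If only the second score can cross the threshold, and it has done so by time `N ^ 2`, then it
is the second score that crosses at the stopping time. -/
theorem score_seqTime (hN : 0 < N) {x₁ x₂ : Fin N → X} {y : ℕ → X}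
    (h1 : ∀ n ∈ Finset.Icc 1 (N ^ 2), ¬ γ * N ≤ score x₁ (initial n y))
    (h2 : γ * N ≤ score x₂ (initial (N ^ 2) y)) :
    γ * N ≤ score x₂ (initial (seqTime γ x₁ x₂ y) y) ∧
      ¬ γ * N ≤ score x₁ (initial (seqTime γ x₁ x₂ y) y) := by
  have hT := h1 _ (Finset.mem_Icc.2 ⟨one_le_seqTime (γ := γ) hN x₁ x₂ y, seqTime_le_sq x₁ x₂ y⟩)
  refine ⟨?_, hT⟩
  rcases Nat.sInf_mem (Set.insert_nonempty (N ^ 2) (crossings γ x₁ x₂ y)) with h | h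
  · rw [seqTime, h]
    exact h2
  · exact h.2.resolve_left hT

variable {Ω : Type*} [MeasurableSpace Ω] (μ : Measure Ω) (f g : Ω → Fin N → X) (y : Ω → ℕ → X)

/-- Here `f` is the matching training word and `g` the other one. Outside the events on the right,
`score_seqTime` forces the correct crossing pattern. -/
theorem measure_le_of_wrong_score (hN : 0 < N) {E : Set Ω}
    (hE : ∀ ω ∈ E, ¬ (γ * N ≤ score (g ω) (initial (seqTime γ (f ω) (g ω) (y ω)) (y ω)) ∧
      ¬ γ * N ≤ score (f ω) (initial (seqTime γ (f ω) (g ω) (y ω)) (y ω)))) :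
    μ E ≤ ∑ n ∈ Finset.Icc 1 (N ^ 2), μ {ω | γ * N ≤ score (f ω) (initial n (y ω))} +
      μ {ω | score (g ω) (initial (N ^ 2) (y ω)) < γ * N} := by
  have hsub : E ⊆ (⋃ n ∈ Finset.Icc 1 (N ^ 2), {ω | γ * N ≤ score (f ω) (initial n (y ω))}) ∪
      {ω | score (g ω) (initial (N ^ 2) (y ω)) < γ * N} := by
    intro ω hω
    by_contra hc
    simp only [Set.mem_union, Set.mem_iUnion, Set.mem_ofPred_eq, not_or, not_exists, not_lt] at hc
    exact hE ω hω (score_seqTime hN hc.1 hc.2)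
  exact (measure_mono hsub).trans ((measure_union_le _ _).trans
    (add_le_add_left (measure_biUnion_finset_le _ _) _))

/-- Either the score of `g` has crossed at time `n`, so that the test has stopped by then, or the
cap `N ^ 2` applies. -/
theorem lintegral_seqTime_le [IsProbabilityMeasure μ] {n : ℕ} (hn : 0 < n) :
    ∫⁻ ω, (seqTime γ (f ω) (g ω) (y ω) : ℝ≥0∞) ∂μ ≤
      n + (N : ℝ≥0∞) ^ 2 * μ {ω | score (g ω) (initial n (y ω)) < γ * N} := by
  set A := {ω | score (g ω) (initial n (y ω)) < γ * N}
  calc ∫⁻ ω, (seqTime γ (f ω) (g ω) (y ω) : ℝ≥0∞) ∂μ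
      ≤ ∫⁻ ω, ((n : ℝ≥0∞) + A.indicator (fun _ => (N : ℝ≥0∞) ^ 2) ω) ∂μ := by
        refine lintegral_mono fun ω => ?_
        by_cases hω : ω ∈ A
        · rw [Set.indicator_of_mem hω]
          refine le_add_left ?_
          exact_mod_cast seqTime_le_sq (γ := γ) (f ω) (g ω) (y ω)
        · rw [Set.indicator_of_notMem hω, add_zero]
          exact Nat.cast_le.2 (seqTime_le_of_score_right hn (not_lt.1 hω))
    _ = n + ∫⁻ ω, A.indicator (fun _ => (N : ℝ≥0∞) ^ 2) ω ∂μ := by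
        rw [lintegral_add_left measurable_const, lintegral_const, measure_univ, mul_one]
    _ ≤ _ := by
        gcongr
        refine (lintegral_indicator_le _ _).trans (le_of_eq ?_)
        rw [setLIntegral_const]

theorem one_le_lintegral_seqTime [IsProbabilityMeasure μ] (hN : 0 < N) :
    1 ≤ ∫⁻ ω, (seqTime γ (f ω) (g ω) (y ω) : ℝ≥0∞) ∂μ := by
  calc (1 : ℝ≥0∞) = ∫⁻ _, 1 ∂μ := by simp
    _ ≤ _ := lintegral_mono fun ω =>
        Nat.one_le_cast.2 (one_le_seqTime (γ := γ) hN (f ω) (g ω) (y ω))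

end Time

/-! ### Assembly of the two hypotheses. -/

theorem isTheSolution_of_eq {P Q : PMF X} {γ β : ℝ} (hne : pmfReal P ≠ pmfReal Q) (hβ : 0 < β)
    (h : GJS (pmfReal P) (pmfReal Q) β = γ * β) : IsTheSolution P Q γ β :=
  ⟨hβ, h, fun _ ha h' =>
    solution_unique (isProb_pmfReal P) (isProb_pmfReal Q) hne ha hβ h' h⟩

/-- The error exponent of the sequential test, in terms of bounds on the error probabilities `Err`
and on the expected stopping times `ET` when the test sequence has law `q`. -/
theorem exponent_of_bounds {p q : X → ℝ} {η γ β : ℝ} {Err ET : ℕ → ℝ≥0∞} (hp : IsProb p)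
    (hq : IsProb q) (hη : 0 < η) (hη1 : η < 1) (hγ : 0 < γ)
    (hC : chernoffCoeff η q p ≤ Real.exp (-γ)) (hβ : 0 < β) (hsol : GJS p q β = γ * β)
    (hErr : ∀ N, 0 < N → Err N ≤
      ∑ n ∈ Finset.Icc 1 (N ^ 2),
        ENNReal.ofReal (pairProb q q N n fun x y => γ * N ≤ score x y) +
      ENNReal.ofReal (pairProb p q N (N ^ 2) fun x y => score x y < γ * N))
    (hET : ∀ N n, 0 < n → ET N ≤ n + (N : ℝ≥0∞) ^ 2 *
      ENNReal.ofReal (pairProb p q N n fun x y => score x y < γ * N))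
    (hET1 : ∀ N, 0 < N → 1 ≤ ET N) :
    Tendsto Err atTop (𝓝 0) ∧ ((GJS p q β : ℝ) : EReal) ≤
      liminf (fun N => -ENNReal.log (Err N) / ((ET N : ℝ≥0∞) : EReal)) atTop := by
  have hE : ∀ δ > 0, ∀ᶠ N : ℕ in atTop,
      Err N ≤ ENNReal.ofReal (Real.exp (-(N * (γ - δ)))) :=
    fun δ hδ => eventually_err_le hp hq hη hη1 hC hErr hδ
  refine ⟨tendsto_err hγ hE, ?_⟩
  rw [hsol]
  refine le_liminf_exponent hγ hβ hE (fun t ht => ?_) hET1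
  have ht0 : 0 < t := (by positivity : 0 < 1 / β).trans ht
  exact eventually_expectedTime_le hp hq ht0
    (lt_GJS_of_lt_solution hp hq (ne_of_chernoffCoeff_le hp hη hγ hC) (by positivity)
      ((one_div_lt hβ ht0).1 ht) hsol) hET

end SeqClass

end

theorem corollary1 {X : Type*} [Fintype X] [MeasurableSpace X] [MeasurableSingletonClass X]
    (P₁ P₂ : PMF X) (γ : ℝ) (hγ : 0 < γ) (hγC : (γ : EReal) ≤ SeqClass.chernoff P₁ P₂)
    (hsupp : (γ : EReal) = SeqClass.chernoff P₁ P₂ → P₁.support = P₂.support) :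
    ∃ β θ : ℝ, SeqClass.IsTheSolution P₂ P₁ γ β ∧ SeqClass.IsTheSolution P₁ P₂ γ θ ∧
      ∀ d : (N : ℕ) → (Fin N → X) → (Fin N → X) → (n : ℕ) → (Fin n → X) → SeqClass.Hyp,
        (∀ N : ℕ, SeqClass.IsSeqRule γ (d N)) →
        (Tendsto (fun N => SeqClass.errorProb P₁ P₂ SeqClass.Hyp.H1 (SeqClass.seqTest γ (d N)))
            atTop (𝓝 0) ∧
          ((SeqClass.GJS (SeqClass.pmfReal P₂) (SeqClass.pmfReal P₁) β : ℝ) : EReal) ≤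
            SeqClass.errorExponent P₁ P₂ SeqClass.Hyp.H1
              (fun N => SeqClass.seqTest γ (d N))) ∧
        (Tendsto (fun N => SeqClass.errorProb P₁ P₂ SeqClass.Hyp.H2 (SeqClass.seqTest γ (d N)))
            atTop (𝓝 0) ∧
          ((SeqClass.GJS (SeqClass.pmfReal P₁) (SeqClass.pmfReal P₂) θ : ℝ) : EReal) ≤
            SeqClass.errorExponent P₁ P₂ SeqClass.Hyp.H2
              (fun N => SeqClass.seqTest γ (d N))) := by
  obtain ⟨η, hη, hη1, hC⟩ := SeqClass.exists_chernoffCoeff_le P₁ P₂ hγ hγC hsupp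
  have hη' : 0 < 1 - η := by linarith
  have hη1' : 1 - η < 1 := by linarith
  have hC' := hC
  -- Under the second hypothesis the laws exchange roles, and so do `η` and `1 - η`.
  rw [← SeqClass.chernoffCoeff_symm] at hC'
  have hP₁ := SeqClass.isProb_pmfReal P₁
  have hP₂ := SeqClass.isProb_pmfReal P₂
  have hne := SeqClass.ne_of_chernoffCoeff_le hP₂ hη hγ hC
  obtain ⟨β, hβ, hβs⟩ := SeqClass.exists_solution hP₂ hP₁ hη hη1 hγ hC
  obtain ⟨θ, hθ, hθs⟩ := SeqClass.exists_solution hP₁ hP₂ hη' hη1' hγ hC'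
  refine ⟨β, θ, SeqClass.isTheSolution_of_eq hne hβ hβs,
    SeqClass.isTheSolution_of_eq hne.symm hθ hθs, fun d hd => ⟨?_, ?_⟩⟩
  · refine SeqClass.exponent_of_bounds hP₂ hP₁ hη hη1 hγ hC hβ hβs
      (fun N hN => ?_) (fun N n hn => ?_) (fun N hN => ?_)
    · refine le_trans (SeqClass.measure_le_of_wrong_score (γ := γ) (SeqClass.law P₁ P₂ .H1 N)
        (fun ω => ω.1) (fun ω => ω.2.1) (fun ω => ω.2.2) hN ?_) ?_
      -- The decision rule is forced only when exactly one score has crossed; all other outcomes are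
      -- counted as errors, so the free decisions do not matter.
      · exact fun ω hω hs => hω ((hd N _ _ _ _).1 hs.1 hs.2)
      gcongr with n hn
      · exact SeqClass.law_first_le P₁ P₂ .H1 N n fun x y => γ * N ≤ SeqClass.score x y
      · exact SeqClass.law_second_le P₁ P₂ .H1 N (N ^ 2) fun x y => SeqClass.score x y < γ * N
    · refine (SeqClass.lintegral_seqTime_le (γ := γ) (SeqClass.law P₁ P₂ .H1 N)
        (fun ω => ω.1) (fun ω => ω.2.1) (fun ω => ω.2.2) hn).trans ?_
      gcongr
      exact SeqClass.law_second_le P₁ P₂ .H1 N n fun x y => SeqClass.score x y < γ * N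
    · exact SeqClass.one_le_lintegral_seqTime (γ := γ) (SeqClass.law P₁ P₂ .H1 N)
        (fun ω => ω.1) (fun ω => ω.2.1) (fun ω => ω.2.2) hN
  · refine SeqClass.exponent_of_bounds hP₁ hP₂ hη' hη1' hγ hC' hθ hθs
      (fun N hN => ?_) (fun N n hn => ?_) (fun N hN => ?_)
    · refine le_trans (SeqClass.measure_le_of_wrong_score (γ := γ) (SeqClass.law P₁ P₂ .H2 N)
        (fun ω => ω.2.1) (fun ω => ω.1) (fun ω => ω.2.2) hN ?_) ?_
      · intro ω hω hs
        rw [SeqClass.seqTime_swap] at hs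
        exact hω ((hd N _ _ _ _).2 hs.1 hs.2)
      gcongr with n hn
      · exact SeqClass.law_second_le P₁ P₂ .H2 N n fun x y => γ * N ≤ SeqClass.score x y
      · exact SeqClass.law_first_le P₁ P₂ .H2 N (N ^ 2) fun x y => SeqClass.score x y < γ * N
    · have h := SeqClass.lintegral_seqTime_le (γ := γ) (SeqClass.law P₁ P₂ .H2 N)
        (fun ω => ω.2.1) (fun ω => ω.1) (fun ω => ω.2.2) hn
      simp only [SeqClass.seqTime_swap γ (_ : _ × _ × _).2.1] at h
      refine h.trans ?_
      gcongr
      exact SeqClass.law_first_le P₁ P₂ .H2 N n fun x y => SeqClass.score x y < γ * N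
    · exact SeqClass.one_le_lintegral_seqTime (γ := γ) (SeqClass.law P₁ P₂ .H2 N)
        (fun ω => ω.1) (fun ω => ω.2.1) (fun ω => ω.2.2) hN
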